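/- Let $M$ be a connected smooth surface (without boundary), $X:M\to\mathbb R^3$ a smooth minimal immersion with smooth unit normal field $\mathbf n$ and Gauss curvature $\mathcal K<0$ everywhere. Let $V_1,V_2\in\mathbb R^3$ be orthogonal unit vectors, and write $\mathbf n_V=\langle\mathbf n,V\rangle$. Consider, on the set of points where $\mathbf n\notin\{\pm V_1,\pm V_2\}$ (that is, where the logarithms are defined), the functions $$F=\sum_{V\in\{V_1,-V_1,V_2,-V_2\}}\ln\frac{(1-\mathbf n_V)^2}{\sqrt{-\mathcal K}},\qquad F'=\ln\frac{(1-\mathbf n_{V_1}^2)(1-\mathbf n_{V_2}^2)}{-\mathcal K}.$$ Then $F$ is constant if and only if $F'$ is constant; and if $F$ is constant, then $(X,\mathbf n)$ is, up to a homothety and a congruence of $\mathbb R^3$, a part of a member $\Sigma_\Theta$, $\Theta\in[0,\pi/2]$, of the associate family that connects the doubly periodic Scherk graph ($\Theta=0$) and the singly periodic Scherk tower ($\Theta=\pi/2$). Here $\Sigma_\Theta$ is the complete immersed minimal surface with Weierstrass data $G=z$, $\frac1G\,dh=e^{i\Theta}\frac{dG}{G^4-1}$ on the Riemann sphere punctured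 at $\pm1,\pm i$: its points are given by all values of $$\mathrm{Re}\int_0^{z}\Big(\tfrac12\big(\tfrac1G-G\big),\ \tfrac i2\big(\tfrac1G+G\big),\ 1\Big)\,dh$$ along piecewise $C^1$ paths from $0$ to $z$ avoiding the punctures (with $z=\infty$ allowed), and its unit normal there is $\pi^{-1}(z)$, where $\pi$ is the stereographic projection from the north pole. "A part of $\Sigma_\Theta$ up to homothety and congruence" means that there are $\rho>0$ and an isometry $A$ of $\mathbb R^3$ with linear part $A_0$ such that for every $p\in M$ there is a point of $\Sigma_\Theta$ with position $P$ and unit normal $N$ for which $X(p)=A(\rho P)$ and $\mathbf n(p)=A_0N$. -/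

import Mathlib

open scoped Manifold ContDiff

noncomputable section

/-- Euclidean three-space. -/
abbrev E3 : Type := EuclideanSpace ℝ (Fin 3)

/-! ### Immersed surfaces in Euclidean three-space -/

section Surface

variable {M : Type*} [TopologicalSpace M] [ChartedSpace (EuclideanSpace ℝ (Fin 2)) M]

/-- The differential at `p` of a map from a surface to Euclidean three-space. -/
def surfDeriv (f : M → E3) (p : M) : TangentSpace (𝓡 2) p →ₗ[ℝ] E3 :=
  (mfderiv (𝓡 2) 𝓘(ℝ, E3) f p).toLinearMap

/-- `X` is a smooth immersion of the surface `M` and `n` is a smooth unit normal field along it. -/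
structure IsOrientedImmersion (X n : M → E3) : Prop where
  smooth : ContMDiff (𝓡 2) 𝓘(ℝ, E3) ∞ X
  immersion : ∀ p, Function.Injective (surfDeriv X p)
  normal_smooth : ContMDiff (𝓡 2) 𝓘(ℝ, E3) ∞ n
  normal_unit : ∀ p, ‖n p‖ = 1
  normal_orthogonal : ∀ p v, inner ℝ (n p) (surfDeriv X p v) = 0

/-- The shape operator (Weingarten map) `S = -(dX)⁻¹ ∘ dn` of the tangent plane at `p`.  For an
oriented immersion `dn` takes its values in the range of the injective map `dX`, so the choice of
a left inverse of `dX` does not matter. -/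
def shapeOperator (X n : M → E3) (p : M) : TangentSpace (𝓡 2) p →ₗ[ℝ] TangentSpace (𝓡 2) p :=
  -((surfDeriv X p).leftInverse ∘ₗ surfDeriv n p)

/-- The mean curvature, half the trace of the shape operator. -/
def meanCurvature (X n : M → E3) (p : M) : ℝ :=
  LinearMap.trace ℝ (TangentSpace (𝓡 2) p) (shapeOperator X n p) / 2

/-- The Gauss curvature, the determinant of the shape operator. -/
def gaussCurvature (X n : M → E3) (p : M) : ℝ :=
  LinearMap.det (shapeOperator X n p)

/-- An oriented immersed minimal surface: the mean curvature vanishes identically. -/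
structure IsMinimalSurface (X n : M → E3) : Prop extends IsOrientedImmersion X n where
  minimal : ∀ p, meanCurvature X n p = 0

/-- The summand `ln ((1 - n_V)² / √(-K))`, where `n_V = ⟨n, V⟩`. -/
def chernRicci (X n : M → E3) (V : E3) (p : M) : ℝ :=
  Real.log ((1 - inner ℝ (n p) V) ^ 2 / Real.sqrt (-gaussCurvature X n p))

/-- The Chern-Ricci function of the four directions `V₁, -V₁, V₂, -V₂`. -/
def chernRicciSum (X n : M → E3) (V₁ V₂ : E3) (p : M) : ℝ :=
  chernRicci X n V₁ p + chernRicci X n (-V₁) p + chernRicci X n V₂ p + chernRicci X n (-V₂) p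

/-- The function `ln ((1 - n_{V₁}²) (1 - n_{V₂}²) / (-K))`. -/
def scherkLog (X n : M → E3) (V₁ V₂ : E3) (p : M) : ℝ :=
  Real.log ((1 - inner ℝ (n p) V₁ ^ 2) * (1 - inner ℝ (n p) V₂ ^ 2) / (-gaussCurvature X n p))

/-- The points where the logarithms above have positive arguments (on a surface with `K < 0`):
the normal is none of `V₁, -V₁, V₂, -V₂`. -/
def scherkRegular (n : M → E3) (V₁ V₂ : E3) : Set M :=
  {p | n p ≠ V₁ ∧ n p ≠ -V₁ ∧ n p ≠ V₂ ∧ n p ≠ -V₂}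

end Surface

/-! ### The associate family of Scherk's surfaces

The member of angle `Θ` is the minimal surface with Weierstrass data
`G = z`, `dh = e^{iΘ} z dz / (z⁴ - 1)` on the Riemann sphere punctured at the four points with
`z⁴ = 1`.  Points of the sphere are written in homogeneous coordinates, `z = u / v`, so that `z = ∞`
(where the data are regular) is included; `dz = (v du - u dv) / v²`. -/

/-- The three forms `½ (1/G - G) dh`, `(i/2) (1/G + G) dh`, `dh` for `G = u / v` and
`dh = G dG / (G⁴ - 1)`, in homogeneous coordinates. -/
def scherkForm (u v du dv : ℂ) : Fin 3 → ℂ :=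
  ![(v ^ 2 - u ^ 2) / 2 * ((v * du - u * dv) / (u ^ 4 - v ^ 4)),
    Complex.I * (v ^ 2 + u ^ 2) / 2 * ((v * du - u * dv) / (u ^ 4 - v ^ 4)),
    u * v * ((v * du - u * dv) / (u ^ 4 - v ^ 4))]

/-- The forms in the affine coordinate `G = z`. -/
theorem scherkForm_affine (z dz : ℂ) (hz : z ≠ 0) :
    scherkForm z 1 dz 0 =
      ![(1 / z - z) / 2 * (z / (z ^ 4 - 1) * dz),
        Complex.I / 2 * (1 / z + z) * (z / (z ^ 4 - 1) * dz),
        z / (z ^ 4 - 1) * dz] := by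
  funext k
  fin_cases k <;> simp [scherkForm] <;> field_simp

/-- The real displacement `Re ∫ e^{iΘ} (½ (1/G - G) dh, (i/2) (1/G + G) dh, dh)` along the
path `t ↦ u t / v t`, `0 ≤ t ≤ 1`. -/
def scherkIntegral (Θ : ℝ) (u v : ℝ → ℂ) : E3 :=
  WithLp.toLp 2 fun k =>
    (∫ t in (0 : ℝ)..1,
      Complex.exp (Θ * Complex.I) * scherkForm (u t) (v t) (deriv u t) (deriv v t) k).re

/-- `ScherkReach Θ u v P`: the point `P` is a value at `z = u / v` of the Weierstrass integral of
angle `Θ` along a piecewise continuously differentiable path that starts at `z = 0` and avoids the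
four punctures. -/
inductive ScherkReach (Θ : ℝ) : ℂ → ℂ → E3 → Prop
  | base : ScherkReach Θ 0 1 0
  | step {P : E3} (u v : ℝ → ℂ) (hu : ContDiff ℝ 1 u) (hv : ContDiff ℝ 1 v)
      (hne : ∀ t ∈ Set.Icc (0 : ℝ) 1, u t ^ 4 ≠ v t ^ 4)
      (hP : ScherkReach Θ (u 0) (v 0) P) :
      ScherkReach Θ (u 1) (v 1) (P + scherkIntegral Θ u v)

/-- The inverse stereographic projection (from the north pole) of `z = u / v`. -/
def sphereOf (u v : ℂ) : E3 :=
  !₂[2 * (u * star v).re / (‖u‖ ^ 2 + ‖v‖ ^ 2),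
     2 * (u * star v).im / (‖u‖ ^ 2 + ‖v‖ ^ 2),
     (‖u‖ ^ 2 - ‖v‖ ^ 2) / (‖u‖ ^ 2 + ‖v‖ ^ 2)]

/-- The member of angle `Θ` of the associate family, as the set of pairs (position, unit normal) at
the points of this complete immersed surface.  The Gauss map is `z`, a local diffeomorphism, and the
values of the Weierstrass integral at one `z` differ by periods, so the point of the surface (not
only its image in space, which may have self-intersections) is recorded by such a pair. -/
def scherkMember (Θ : ℝ) : Set (E3 × E3) :=
  {q | ∃ u v : ℂ, ScherkReach Θ u v q.1 ∧ q.2 = sphereOf u v}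

/-- The oriented surface `(X, n)` is, up to a homothety and a congruence, a part of the
surface whose pairs (position, unit normal) are the elements of `S`. -/
def IsSimilarToPartOf {M : Type*} (X n : M → E3) (S : Set (E3 × E3)) : Prop :=
  ∃ ρ : ℝ, 0 < ρ ∧ ∃ A : E3 ≃ᵃⁱ[ℝ] E3, ∀ p : M, ∃ q ∈ S,
    X p = A (ρ • q.1) ∧ n p = A.linearIsometryEquiv q.2

/-! ### The two ends of the family: `Θ = 0` and `Θ = π / 2` -/

theorem exp_integral_logDeriv (f : ℝ → ℂ) (hf : ContDiff ℝ 1 f)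
    (h0 : ∀ t ∈ Set.Icc (0 : ℝ) 1, f t ≠ 0) :
    IntervalIntegrable (fun t => deriv f t / f t) MeasureTheory.volume 0 1 ∧
      f 0 * Complex.exp (∫ t in (0 : ℝ)..1, deriv f t / f t) = f 1 := by
  have hd : Continuous (deriv f) := hf.continuous_deriv le_rfl
  have hc : ContinuousOn (fun t => deriv f t / f t) (Set.Icc 0 1) :=
    hd.continuousOn.div hf.continuous.continuousOn h0
  have hi : IntervalIntegrable (fun t => deriv f t / f t) MeasureTheory.volume 0 1 := by
    apply ContinuousOn.intervalIntegrable
    rwa [Set.uIcc_of_le zero_le_one]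
  refine ⟨hi, ?_⟩
  set L : ℝ → ℂ := fun s => ∫ t in (0 : ℝ)..s, deriv f t / f t with hL
  have hLc : ContinuousOn L (Set.Icc 0 1) := by
    have := intervalIntegral.continuousOn_primitive_interval' hi (Set.left_mem_uIcc)
    rwa [Set.uIcc_of_le zero_le_one] at this
  have hLd : ∀ s ∈ Set.Ioo (0 : ℝ) 1, HasDerivAt L (deriv f s / f s) s := by
    intro s hs
    have hn : Set.Icc (0 : ℝ) 1 ∈ nhds s := Icc_mem_nhds hs.1 hs.2
    apply intervalIntegral.integral_hasDerivAt_right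
    · exact hi.mono_set (by
        rw [Set.uIcc_of_le hs.1.le, Set.uIcc_of_le zero_le_one]
        exact Set.Icc_subset_Icc_right hs.2.le)
    · exact ⟨_, hn, hc.aestronglyMeasurable measurableSet_Icc⟩
    · exact hc.continuousAt hn
  have hg : ContinuousOn (fun s => f s * Complex.exp (-L s)) (Set.Icc 0 1) :=
    hf.continuous.continuousOn.mul (Complex.continuous_exp.comp_continuousOn hLc.neg)
  have hgd : ∀ s ∈ Set.Ioo (0 : ℝ) 1, HasDerivAt (fun s => f s * Complex.exp (-L s)) 0 s := by
    intro s hs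
    have h1 : HasDerivAt f (deriv f s) s :=
      ((hf.differentiable one_ne_zero) s).hasDerivAt
    have h2 := h1.mul (((hLd s hs).neg).cexp)
    have h3 := h0 s ⟨hs.1.le, hs.2.le⟩
    have h4 : deriv f s * Complex.exp (-L s) +
        f s * (Complex.exp (-L s) * -(deriv f s / f s)) = 0 := by
      field_simp
      ring
    exact h4 ▸ h2
  have key : (fun s => f s * Complex.exp (-L s)) 1 - (fun s => f s * Complex.exp (-L s)) 0 = 0 := by
    rw [← intervalIntegral.integral_eq_sub_of_hasDerivAt_of_le zero_le_one hg hgd (by simp)]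
    simp
  have hL0 : L 0 = 0 := by simp [hL]
  simp only [hL0, neg_zero, Complex.exp_zero, mul_one] at key
  rw [sub_eq_zero] at key
  rw [← key]
  change f 1 * Complex.exp (-L 1) * Complex.exp (L 1) = f 1
  rw [mul_assoc, ← Complex.exp_add]
  simp

theorem scherk_factor (u v : ℂ) :
    v ^ 4 - u ^ 4 = (v - u) * (v + u) * (v - Complex.I * u) * (v + Complex.I * u) := by
  have hI : Complex.I ^ 2 = -1 := Complex.I_sq
  linear_combination (v ^ 2 * u ^ 2 - u ^ 4) * hI

/-- The Weierstrass integral in closed form: each of the four logarithms is continued along the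
path. -/
theorem ScherkReach.closed_form {Θ : ℝ} {u v : ℂ} {P : E3} (h : ScherkReach Θ u v P) :
    ∃ a b c d : ℂ, Complex.exp a = v - u ∧ Complex.exp b = v + u ∧
      Complex.exp c = v - Complex.I * u ∧ Complex.exp d = v + Complex.I * u ∧
      P 0 = (Complex.exp (Θ * Complex.I) * (Complex.I * (d - c) / 4)).re ∧
      P 1 = (Complex.exp (Θ * Complex.I) * (Complex.I * (a - b) / 4)).re ∧
      P 2 = (Complex.exp (Θ * Complex.I) * ((a + b - c - d) / 4)).re := by
  induction h with
  | base => exact ⟨0, 0, 0, 0, by simp⟩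
  | @step P u v hu hv hne _ ih =>
    obtain ⟨a, b, c, d, ha, hb, hc, hd, h0, h1, h2⟩ := ih
    have hI : Complex.I ^ 2 = -1 := Complex.I_sq
    have hfac : ∀ t ∈ Set.Icc (0 : ℝ) 1, v t - u t ≠ 0 ∧ v t + u t ≠ 0 ∧
        v t - Complex.I * u t ≠ 0 ∧ v t + Complex.I * u t ≠ 0 := by
      intro t ht
      have h4 : v t ^ 4 - u t ^ 4 ≠ 0 := sub_ne_zero.2 (hne t ht).symm
      rw [scherk_factor] at h4
      simp only [mul_ne_zero_iff] at h4
      tauto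
    have hdu : ∀ t, HasDerivAt u (deriv u t) t := fun t =>
      ((hu.differentiable one_ne_zero) t).hasDerivAt
    have hdv : ∀ t, HasDerivAt v (deriv v t) t := fun t =>
      ((hv.differentiable one_ne_zero) t).hasDerivAt
    have da : ∀ t, deriv (fun t => v t - u t) t = deriv v t - deriv u t := fun t =>
      ((hdv t).sub (hdu t)).deriv
    have db : ∀ t, deriv (fun t => v t + u t) t = deriv v t + deriv u t := fun t =>
      ((hdv t).add (hdu t)).deriv
    have dc : ∀ t, deriv (fun t => v t - Complex.I * u t) t = deriv v t - Complex.I * deriv u t :=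
      fun t => ((hdv t).sub ((hdu t).const_mul _)).deriv
    have dd : ∀ t, deriv (fun t => v t + Complex.I * u t) t = deriv v t + Complex.I * deriv u t :=
      fun t => ((hdv t).add ((hdu t).const_mul _)).deriv
    obtain ⟨ia, ea⟩ := exp_integral_logDeriv (fun t => v t - u t) (hv.sub hu)
      fun t ht => (hfac t ht).1
    obtain ⟨ib, eb⟩ := exp_integral_logDeriv (fun t => v t + u t) (hv.add hu)
      fun t ht => (hfac t ht).2.1
    obtain ⟨ic, ec⟩ := exp_integral_logDeriv (fun t => v t - Complex.I * u t)
      (hv.sub (contDiff_const.mul hu)) fun t ht => (hfac t ht).2.2.1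
    obtain ⟨id', ed⟩ := exp_integral_logDeriv (fun t => v t + Complex.I * u t)
      (hv.add (contDiff_const.mul hu)) fun t ht => (hfac t ht).2.2.2
    simp only [da] at ia ea
    simp only [db] at ib eb
    simp only [dc] at ic ec
    simp only [dd] at id' ed
    refine ⟨a + ∫ t in (0 : ℝ)..1, (deriv v t - deriv u t) / (v t - u t),
      b + ∫ t in (0 : ℝ)..1, (deriv v t + deriv u t) / (v t + u t),
      c + ∫ t in (0 : ℝ)..1, (deriv v t - Complex.I * deriv u t) / (v t - Complex.I * u t),
      d + ∫ t in (0 : ℝ)..1, (deriv v t + Complex.I * deriv u t) / (v t + Complex.I * u t), by rw [Complex.exp_add, ha]; exact ea,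
      by rw [Complex.exp_add, hb]; exact eb, by rw [Complex.exp_add, hc]; exact ec,
      by rw [Complex.exp_add, hd]; exact ed, ?_, ?_, ?_⟩
    · rw [PiLp.add_apply, h0, scherkIntegral, ← Complex.add_re]
      congr 1
      rw [show (∫ t in (0 : ℝ)..1, Complex.exp (Θ * Complex.I) *
          scherkForm (u t) (v t) (deriv u t) (deriv v t) 0) =
          ∫ t in (0 : ℝ)..1, Complex.exp (Θ * Complex.I) * Complex.I / 4 *
            ((deriv v t + Complex.I * deriv u t) / (v t + Complex.I * u t) -
            (deriv v t - Complex.I * deriv u t) / (v t - Complex.I * u t)) from ?_]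
      · rw [intervalIntegral.integral_const_mul, intervalIntegral.integral_sub id' ic]
        ring
      · apply intervalIntegral.integral_congr
        intro t ht
        rw [Set.uIcc_of_le zero_le_one] at ht
        obtain ⟨p1, p2, p3, p4⟩ := hfac t ht
        have e : u t ^ 4 - v t ^ 4 ≠ 0 := sub_ne_zero.2 (hne t ht)
        simp only [scherkForm, Matrix.cons_val_zero]
        have e2 : v t ^ 2 + u t ^ 2 ≠ 0 := by
          have := mul_ne_zero p4 p3
          intro h
          apply this
          linear_combination h - u t ^ 2 * hI
        rw [div_sub_div _ _ p4 p3]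
        rw [show (v t + Complex.I * u t) * (v t - Complex.I * u t) = v t ^ 2 + u t ^ 2 by
          linear_combination -(u t ^ 2) * hI]
        rw [show u t ^ 4 - v t ^ 4 = -((v t - u t) * (v t + u t) *
          (v t ^ 2 + u t ^ 2)) by ring]
        field_simp
        linear_combination (v t ^ 2 - u t ^ 2) * (u t * deriv v t - v t * deriv u t) * 4 * hI
    · rw [PiLp.add_apply, h1, scherkIntegral, ← Complex.add_re]
      congr 1
      rw [show (∫ t in (0 : ℝ)..1, Complex.exp (Θ * Complex.I) *
          scherkForm (u t) (v t) (deriv u t) (deriv v t) 1) =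
          ∫ t in (0 : ℝ)..1, Complex.exp (Θ * Complex.I) * Complex.I / 4 *
            ((deriv v t - deriv u t) / (v t - u t) -
            (deriv v t + deriv u t) / (v t + u t)) from ?_]
      · rw [intervalIntegral.integral_const_mul, intervalIntegral.integral_sub ia ib]
        ring
      · apply intervalIntegral.integral_congr
        intro t ht
        rw [Set.uIcc_of_le zero_le_one] at ht
        obtain ⟨p1, p2, p3, p4⟩ := hfac t ht
        have e : u t ^ 4 - v t ^ 4 ≠ 0 := sub_ne_zero.2 (hne t ht)
        have e2 : v t ^ 2 + u t ^ 2 ≠ 0 := by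
          have := mul_ne_zero p4 p3
          intro h
          apply this
          linear_combination h - u t ^ 2 * hI
        simp only [scherkForm, Matrix.cons_val_one, Matrix.cons_val_zero]
        rw [show u t ^ 4 - v t ^ 4 = -((v t - u t) * (v t + u t) *
          (v t ^ 2 + u t ^ 2)) by ring]
        field_simp
        ring
    · rw [PiLp.add_apply, h2, scherkIntegral, ← Complex.add_re]
      congr 1
      rw [show (∫ t in (0 : ℝ)..1, Complex.exp (Θ * Complex.I) *
          scherkForm (u t) (v t) (deriv u t) (deriv v t) 2) =
          ∫ t in (0 : ℝ)..1, Complex.exp (Θ * Complex.I) / 4 *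
            (((deriv v t - deriv u t) / (v t - u t) +
            (deriv v t + deriv u t) / (v t + u t)) -
            ((deriv v t - Complex.I * deriv u t) / (v t - Complex.I * u t) +
            (deriv v t + Complex.I * deriv u t) / (v t + Complex.I * u t))) from ?_]
      · rw [intervalIntegral.integral_const_mul, intervalIntegral.integral_sub (ia.add ib)
          (ic.add id'), intervalIntegral.integral_add ia ib, intervalIntegral.integral_add ic id']
        ring
      · apply intervalIntegral.integral_congr
        intro t ht
        rw [Set.uIcc_of_le zero_le_one] at ht
        obtain ⟨p1, p2, p3, p4⟩ := hfac t ht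
        have e : u t ^ 4 - v t ^ 4 ≠ 0 := sub_ne_zero.2 (hne t ht)
        have e2 : v t ^ 2 + u t ^ 2 ≠ 0 := by
          have := mul_ne_zero p4 p3
          intro h
          apply this
          linear_combination h - u t ^ 2 * hI
        simp only [scherkForm, Matrix.cons_val]
        rw [div_add_div _ _ p1 p2, div_add_div _ _ p3 p4]
        rw [show (v t - Complex.I * u t) * (v t + Complex.I * u t) = v t ^ 2 + u t ^ 2 by
          linear_combination -(u t ^ 2) * hI]
        rw [show u t ^ 4 - v t ^ 4 = -((v t - u t) * (v t + u t) *
          (v t ^ 2 + u t ^ 2)) by ring]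
        field_simp
        linear_combination -(v t ^ 2 - u t ^ 2) * 2 * u t * deriv u t * hI

/-- The doubly periodic Scherk surface: the analytic extension of the graph
`z = ln (cos y / cos x)`. -/
def doublyPeriodicScherk : Set E3 :=
  {p | Real.exp (p 2) * Real.cos (p 0) = Real.cos (p 1)}

/-- The singly periodic Scherk tower. -/
def singlyPeriodicScherk : Set E3 :=
  {p | Real.sin (p 2) = Real.sinh (p 0) * Real.sinh (p 1)}

/-- Every point of the member of angle `0` lies, up to a homothety and a congruence, on the doubly
periodic Scherk surface. -/
theorem scherkMember_zero {q : E3 × E3} (hq : q ∈ scherkMember 0) :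
    !₂[4 * q.1 1, 4 * q.1 0, 4 * q.1 2] ∈ doublyPeriodicScherk := by
  obtain ⟨u, v, h, -⟩ := hq
  obtain ⟨a, b, c, d, ha, hb, hc, hd, h0, h1, h2⟩ := h.closed_form
  have e0 : 4 * q.1 0 = c.im - d.im := by rw [h0]; simp; ring
  have e1 : 4 * q.1 1 = b.im - a.im := by rw [h1]; simp; ring
  have e2 : 4 * q.1 2 = a.re + b.re - c.re - d.re := by rw [h2]; simp; ring
  have key : Real.exp (a.re + b.re) * Real.cos (b.im - a.im) =
      Real.exp (c.re + d.re) * Real.cos (c.im - d.im) := by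
    have har := congrArg Complex.re ha
    have hai := congrArg Complex.im ha
    have hbr := congrArg Complex.re hb
    have hbi := congrArg Complex.im hb
    have hcr := congrArg Complex.re hc
    have hci := congrArg Complex.im hc
    have hdr := congrArg Complex.re hd
    have hdi := congrArg Complex.im hd
    simp [Complex.exp_re, Complex.exp_im] at har hai hbr hbi hcr hci hdr hdi
    rw [Real.exp_add, Real.exp_add, Real.cos_sub, Real.cos_sub]
    have l : Real.exp a.re * Real.exp b.re *
        (Real.cos b.im * Real.cos a.im + Real.sin b.im * Real.sin a.im) =
        (v.re - u.re) * (v.re + u.re) + (v.im - u.im) * (v.im + u.im) := by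
      rw [← har, ← hai, ← hbr, ← hbi]; ring
    have r : Real.exp c.re * Real.exp d.re *
        (Real.cos c.im * Real.cos d.im + Real.sin c.im * Real.sin d.im) =
        (v.re + u.im) * (v.re - u.im) + (v.im - u.re) * (v.im + u.re) := by
      rw [← hcr, ← hci, ← sub_eq_add_neg] at *
      rw [← hdr, ← hdi]; ring
    rw [l, r]; ring
  change Real.exp (4 * q.1 2) * Real.cos (4 * q.1 1) = Real.cos (4 * q.1 0)
  rw [e0, e1, e2, show a.re + b.re - c.re - d.re = (a.re + b.re) - (c.re + d.re) by ring,
    Real.exp_sub, div_mul_eq_mul_div, key]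
  field_simp

/-- Every point of the member of angle `π / 2` lies, up to a homothety and a congruence, on the
singly periodic Scherk tower. -/
theorem scherkMember_pi_div_two {q : E3 × E3} (hq : q ∈ scherkMember (Real.pi / 2)) :
    !₂[4 * q.1 0, 4 * q.1 1, 4 * q.1 2] ∈ singlyPeriodicScherk := by
  obtain ⟨u, v, h, -⟩ := hq
  obtain ⟨a, b, c, d, ha, hb, hc, hd, h0, h1, h2⟩ := h.closed_form
  have hE : Complex.exp ((Real.pi / 2 : ℝ) * Complex.I) = Complex.I := by
    push_cast
    exact Complex.exp_pi_div_two_mul_I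
  rw [hE] at h0 h1 h2
  have e0 : 4 * q.1 0 = c.re - d.re := by rw [h0]; simp; ring
  have e1 : 4 * q.1 1 = b.re - a.re := by rw [h1]; simp; ring
  have e2 : 4 * q.1 2 = (c.im + d.im) - (a.im + b.im) := by rw [h2]; simp; ring
  have har := congrArg Complex.re ha
  have hai := congrArg Complex.im ha
  have hbr := congrArg Complex.re hb
  have hbi := congrArg Complex.im hb
  have hcr := congrArg Complex.re hc
  have hci := congrArg Complex.im hc
  have hdr := congrArg Complex.re hd
  have hdi := congrArg Complex.im hd
  simp only [Complex.exp_re, Complex.exp_im, Complex.add_re, Complex.add_im, Complex.sub_re,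
    Complex.sub_im, Complex.mul_re, Complex.mul_im, Complex.I_re, Complex.I_im]
    at har hai hbr hbi hcr hci hdr hdi
  have sq : ∀ x : ℂ, Real.exp x.re ^ 2 = (Real.exp x.re * Real.cos x.im) ^ 2 +
      (Real.exp x.re * Real.sin x.im) ^ 2 := fun x => by
    linear_combination -(Real.exp x.re ^ 2) * Real.sin_sq_add_cos_sq x.im
  have sa := sq a
  have sb := sq b
  have sc := sq c
  have sd := sq d
  rw [har, hai] at sa
  rw [hbr, hbi] at sb
  rw [hcr, hci] at sc
  rw [hdr, hdi] at sd
  have pa := Real.exp_pos a.re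
  have pb := Real.exp_pos b.re
  have pc := Real.exp_pos c.re
  have pd := Real.exp_pos d.re
  have l : Real.exp a.re * Real.exp b.re * Real.exp c.re * Real.exp d.re *
      Real.sin ((c.im + d.im) - (a.im + b.im)) = 4 * (u.re * v.re + u.im * v.im) *
        (u.im * v.re - u.re * v.im) := by
    have l1 : Real.exp a.re * Real.exp b.re * Real.exp c.re * Real.exp d.re *
      Real.sin ((c.im + d.im) - (a.im + b.im)) =
      ((Real.exp c.re * Real.sin c.im) * (Real.exp d.re * Real.cos d.im) +
        (Real.exp c.re * Real.cos c.im) * (Real.exp d.re * Real.sin d.im)) *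
      ((Real.exp a.re * Real.cos a.im) * (Real.exp b.re * Real.cos b.im) -
        (Real.exp a.re * Real.sin a.im) * (Real.exp b.re * Real.sin b.im)) -
      ((Real.exp c.re * Real.cos c.im) * (Real.exp d.re * Real.cos d.im) -
        (Real.exp c.re * Real.sin c.im) * (Real.exp d.re * Real.sin d.im)) *
      ((Real.exp a.re * Real.sin a.im) * (Real.exp b.re * Real.cos b.im) +
        (Real.exp a.re * Real.cos a.im) * (Real.exp b.re * Real.sin b.im)) := by
      rw [Real.sin_sub, Real.sin_add, Real.cos_add, Real.sin_add, Real.cos_add]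
      ring
    rw [l1, har, hai, hbr, hbi, hcr, hci, hdr, hdi]
    ring
  have r1 : Real.exp c.re * Real.exp d.re * Real.sinh (c.re - d.re) =
      2 * (u.im * v.re - u.re * v.im) := by
    rw [Real.sinh_eq, neg_sub, Real.exp_sub, Real.exp_sub]
    field_simp
    rw [sc, sd]
    ring
  have r2 : Real.exp a.re * Real.exp b.re * Real.sinh (b.re - a.re) =
      2 * (u.re * v.re + u.im * v.im) := by
    rw [Real.sinh_eq, neg_sub, Real.exp_sub, Real.exp_sub]
    field_simp
    rw [sa, sb]
    ring
  change Real.sin (4 * q.1 2) = Real.sinh (4 * q.1 0) * Real.sinh (4 * q.1 1)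
  rw [e0, e1, e2]
  apply mul_left_cancel₀ (mul_pos (mul_pos (mul_pos pa pb) pc) pd).ne'
  rw [l]
  linear_combination -(2 * (u.re * v.re + u.im * v.im)) * r1 -
    Real.exp c.re * Real.exp d.re * Real.sinh (c.re - d.re) * r2

end

open scoped Manifold ContDiff ComplexConjugate

noncomputable section

/-! On the regular set the two functions differ only by a factor: multiplying the four arguments
gives `F = 2 F'` (`chernRicciSum_eq`). The content is the rigidity statement.

In an orthonormal frame whose first two vectors are `V₁, V₂`, let `z = u / v` be the Gauss map and
let `ω` be the isotropic vector of holomorphic forms of Scherk's surface on the sphere. Since `K <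
0`, the Gauss map is a local coordinate, and minimality makes `dX = Re (h ω)` for a complex function
`h`, the phase. The denominator `u⁴ - v⁴` vanishes exactly over `±V₁, ±V₂`, and a computation gives
`|h|² (-K) = 16 (1 - n_{V₁}²) (1 - n_{V₂}²)`, that is, `|h|² = 16 exp F'`. Closedness of `dX` makes
`h` holomorphic, so a phase of constant modulus is constant. The surface is then `Re ∫ h ω` up to
translation: a piece of `Σ_Θ` scaled by `ρ`, where `h = ρ e^{iΘ}`.

No isothermal coordinates are used. Pointwise, symmetry and vanishing trace of the shape operator
give the complex proportionality behind `h` (`IsLift.exists_weierstrass`). For the constancy, `|h|`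
constant gives `dh = i μ h` with a real form `μ`; closedness and isotropy turn this into `μ ∧ dz =
0`, whence `μ = 0` (`MinimalChart.fderiv_phase_eq_zero`).

A point with normal in `{±V₁, ±V₂}` is isolated, because the normal is an immersion. The phase
extends continuously to it and would vanish there, against its constant nonzero modulus nearby;
hence no such point exists (`MinimalChart.exists_const_phase`). Two symmetries of the frame act on
the phase by `h ↦ conj h` and `h ↦ -conj h`, so `Θ` may be taken in `[0, π/2]`. Finally, agreement
with a continued Weierstrass integral is an open and closed condition on the connected surface
(`HasConstPhase.isSimilarToPartOf`). -/

/-! ### Homogeneous stereographic coordinates -/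

/-- `(u, v)` are homogeneous stereographic coordinates (from the north pole) of `m`. -/
structure IsLift (u v : ℂ) (m : E3) : Prop where
  ne : u * conj u + v * conj v ≠ 0
  xy : (u * conj u + v * conj v) * (m 0 + m 1 * Complex.I) = 2 * u * conj v
  z : (u * conj u + v * conj v) * m 2 = u * conj u - v * conj v

/-- The isotropic vector `(½ (v² - u²), (i/2) (v² + u²), u v)`. -/
def isoVec (u v : ℂ) : Fin 3 → ℂ :=
  ![(v ^ 2 - u ^ 2) / 2, Complex.I * (v ^ 2 + u ^ 2) / 2, u * v]

/-- The complex bilinear product of a real vector with the isotropic vector. -/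
def isoDot (u v : ℂ) (y : E3) : ℂ := ∑ k, (y k : ℂ) * isoVec u v k

theorem isoDot_eq (u v : ℂ) (y : E3) :
    isoDot u v y = ((y 0 + y 1 * Complex.I) * v ^ 2 - (y 0 - y 1 * Complex.I) * u ^ 2) / 2 +
      y 2 * (u * v) := by
  simp [isoDot, isoVec, Fin.sum_univ_three]; ring

theorem isoDot_add (u v : ℂ) (y z : E3) : isoDot u v (y + z) = isoDot u v y + isoDot u v z := by
  simp [isoDot_eq]; ring

theorem isoDot_smul (u v : ℂ) (r : ℝ) (y : E3) : isoDot u v (r • y) = r * isoDot u v y := by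
  simp [isoDot_eq]; ring

theorem scherkForm_eq (u v du dv : ℂ) (k : Fin 3) :
    scherkForm u v du dv k = isoVec u v k * ((v * du - u * dv) / (u ^ 4 - v ^ 4)) := by
  fin_cases k <;> simp [scherkForm, isoVec]

theorem sq_norm_eq_mul_conj (u v : ℂ) :
    ((‖u‖ ^ 2 + ‖v‖ ^ 2 : ℝ) : ℂ) = u * conj u + v * conj v := by
  push_cast; rw [Complex.mul_conj, Complex.mul_conj, Complex.normSq_eq_norm_sq,
    Complex.normSq_eq_norm_sq]; push_cast; ring

namespace IsLift

variable {u v : ℂ} {m : E3}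

theorem pos (h : IsLift u v m) : 0 < ‖u‖ ^ 2 + ‖v‖ ^ 2 := by
  have := h.ne
  rw [← sq_norm_eq_mul_conj] at this
  exact lt_of_le_of_ne (by positivity) (fun e => this (by rw [← e]; simp))

theorem xy_conj (h : IsLift u v m) :
    (u * conj u + v * conj v) * (m 0 - m 1 * Complex.I) = 2 * conj u * v := by
  have := congrArg conj h.xy
  simp only [map_mul, map_add, Complex.conj_conj, Complex.conj_ofReal, Complex.conj_I,
    map_ofNat] at this
  linear_combination this

theorem sphereOf_eq (h : IsLift u v m) : sphereOf u v = m := by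
  have hp := h.pos
  have h1 := h.xy
  have h2 := h.z
  rw [← sq_norm_eq_mul_conj] at h1 h2
  have e0 := congrArg Complex.re h1
  have e1 := congrArg Complex.im h1
  have e2 := congrArg Complex.re h2
  rw [Complex.re_ofReal_mul] at e0 e2
  rw [Complex.im_ofReal_mul] at e1
  have f0 : (2 * u * conj v).re = 2 * (u * star v).re := by simp; ring
  have f1 : (2 * u * conj v).im = 2 * (u * star v).im := by simp; ring
  have f2 : (u * conj u - v * conj v).re = ‖u‖ ^ 2 - ‖v‖ ^ 2 := by
    rw [← Complex.normSq_eq_norm_sq, ← Complex.normSq_eq_norm_sq, Complex.mul_conj,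
      Complex.mul_conj]; simp
  rw [f0] at e0; rw [f1] at e1; rw [f2] at e2
  simp only [Complex.add_re, Complex.add_im, Complex.ofReal_re, Complex.ofReal_im,
    Complex.re_ofReal_mul, Complex.im_ofReal_mul, Complex.I_re, Complex.I_im, mul_zero, mul_one,
    add_zero, zero_add] at e0 e1 e2
  ext k
  fin_cases k
  · simp only [sphereOf]; change _ / _ = m 0; rw [div_eq_iff hp.ne', ← e0]; ring
  · simp only [sphereOf]; change _ / _ = m 1; rw [div_eq_iff hp.ne', ← e1]; ring
  · simp only [sphereOf]; change _ / _ = m 2; rw [div_eq_iff hp.ne', ← e2]; ring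

theorem ne_zero (h : IsLift u v m) : u ≠ 0 ∨ v ≠ 0 := by
  by_contra hc
  push Not at hc
  exact h.ne (by simp [hc.1, hc.2])

end IsLift

theorem isLift_sphereOf {u v : ℂ} (h : u ≠ 0 ∨ v ≠ 0) : IsLift u v (sphereOf u v) := by
  have hp : 0 < ‖u‖ ^ 2 + ‖v‖ ^ 2 := by
    rcases h with h | h
    · have := norm_pos_iff.2 h; positivity
    · have := norm_pos_iff.2 h; positivity
  refine ⟨?_, ?_, ?_⟩
  · rw [← sq_norm_eq_mul_conj]; exact_mod_cast hp.ne'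
  · have e : u * star v = ((u * star v).re : ℂ) + (u * star v).im * Complex.I :=
      (Complex.re_add_im _).symm
    rw [← sq_norm_eq_mul_conj]
    have hp' : ((‖u‖ ^ 2 + ‖v‖ ^ 2 : ℝ) : ℂ) ≠ 0 := by exact_mod_cast hp.ne'
    have e0 : ((sphereOf u v 0 : ℝ) : ℂ) =
        2 * (u * star v).re / ((‖u‖ ^ 2 + ‖v‖ ^ 2 : ℝ) : ℂ) := by
      simp only [sphereOf]; change ((_ / _ : ℝ) : ℂ) = _; push_cast; rfl
    have e1 : ((sphereOf u v 1 : ℝ) : ℂ) =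
        2 * (u * star v).im / ((‖u‖ ^ 2 + ‖v‖ ^ 2 : ℝ) : ℂ) := by
      simp only [sphereOf]; change ((_ / _ : ℝ) : ℂ) = _; push_cast; rfl
    rw [e0, e1]
    have e' : 2 * u * conj v = 2 * (u * star v) := by rw [mul_assoc]; rfl
    rw [e']
    conv_rhs => rw [e]
    field_simp
  · have hp' : ((‖u‖ ^ 2 + ‖v‖ ^ 2 : ℝ) : ℂ) ≠ 0 := by exact_mod_cast hp.ne'
    have e2 : ((sphereOf u v 2 : ℝ) : ℂ) =
        ((‖u‖ ^ 2 - ‖v‖ ^ 2 : ℝ) : ℂ) / ((‖u‖ ^ 2 + ‖v‖ ^ 2 : ℝ) : ℂ) := by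
      simp only [sphereOf]; change ((_ / _ : ℝ) : ℂ) = _; push_cast; rfl
    rw [e2, ← sq_norm_eq_mul_conj, Complex.mul_conj, Complex.mul_conj, mul_div_cancel₀ _ hp',
      Complex.normSq_eq_norm_sq, Complex.normSq_eq_norm_sq]
    push_cast; ring

theorem isoVec_isotropic (u v : ℂ) : ∑ k, isoVec u v k ^ 2 = 0 := by
  simp [isoVec, Fin.sum_univ_three]
  linear_combination ((v ^ 2 + u ^ 2) / 2) ^ 2 * Complex.I_sq

/-- An isotropic complex vector whose real part vanishes is zero. -/
theorem eq_zero_of_re_mul_isoVec {u v c : ℂ} (h : u ≠ 0 ∨ v ≠ 0)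
    (hc : ∀ k, (c * isoVec u v k).re = 0) : c = 0 := by
  -- The real part of an isotropic sum of squares is the squared length of the real part minus that
  -- of the imaginary part; if one vanishes, so does the other.
  have hs : ∑ k, (c * isoVec u v k) ^ 2 = 0 := by
    simp only [mul_pow, ← Finset.mul_sum, isoVec_isotropic, mul_zero]
  have hr := congrArg Complex.re hs
  simp only [Fin.sum_univ_three, Complex.add_re, sq, Complex.mul_re (_ * _) (_ * _), hc,
    Complex.zero_re] at hr
  by_contra hc0
  have hz : ∀ k, isoVec u v k = 0 := by
    intro k
    have h0 : ∀ k, (c * isoVec u v k).im = 0 := by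
      intro k
      fin_cases k <;> simp only [Fin.zero_eta, Fin.mk_one, Fin.reduceFinMk] <;>
        nlinarith [mul_self_nonneg (c * isoVec u v 0).im, mul_self_nonneg (c * isoVec u v 1).im,
          mul_self_nonneg (c * isoVec u v 2).im]
    exact (mul_eq_zero.1 (Complex.ext (hc k) (h0 k))).resolve_left hc0
  have a := hz 0
  have b := hz 2
  simp only [isoVec, Matrix.cons_val] at a b
  rcases mul_eq_zero.1 b with b | b <;> subst b <;> simp_all

namespace IsLift

variable {u v : ℂ} {m : E3}

/-- The factors `u² - v²` and `u² + v²` have squared moduli `D² (1 - m₀²)` and `D² (1 - m₁²)`, where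
`D = |u|² + |v|²`. This is how the numerator of `F'` enters the Weierstrass data. -/
theorem pow_four_normSq (h : IsLift u v m) :
    ‖u ^ 4 - v ^ 4‖ ^ 2 =
      (‖u‖ ^ 2 + ‖v‖ ^ 2) ^ 4 * ((1 - m 0 ^ 2) * (1 - m 1 ^ 2)) := by
  have hI := Complex.I_sq
  rw [← Complex.ofReal_inj, ← Complex.normSq_eq_norm_sq, ← Complex.mul_conj]
  push_cast
  have e := sq_norm_eq_mul_conj u v
  push_cast at e
  rw [e]
  set D := u * conj u + v * conj v with hD
  have x2 : D * m 0 = u * conj v + conj u * v := by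
    linear_combination (h.xy + h.xy_conj) / 2
  have y2 : D * m 1 * Complex.I = u * conj v - conj u * v := by
    linear_combination (h.xy - h.xy_conj) / 2
  have a1 : D ^ 2 * (1 - (m 0 : ℂ) ^ 2) = (u ^ 2 - v ^ 2) * (conj u ^ 2 - conj v ^ 2) := by
    linear_combination -(D * m 0 + (u * conj v + conj u * v)) * x2 +
      (D + u * conj u + v * conj v) * hD
  have a2 : D ^ 2 * (1 - (m 1 : ℂ) ^ 2) = (u ^ 2 + v ^ 2) * (conj u ^ 2 + conj v ^ 2) := by
    linear_combination (D * m 1 * Complex.I + (u * conj v - conj u * v)) * y2 +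
      (D + u * conj u + v * conj v) * hD - D ^ 2 * (m 1) ^ 2 * hI
  simp only [map_sub, map_pow]
  linear_combination -a1 * (D ^ 2 * (1 - (m 1 : ℂ) ^ 2)) -
    (u ^ 2 - v ^ 2) * (conj u ^ 2 - conj v ^ 2) * a2

/-- A real vector orthogonal to `m` is recovered from its product with the isotropic vector. -/
theorem recover (h : IsLift u v m) {y : E3} (hy : inner ℝ m y = 0) (k : Fin 3) :
    y k = (4 / ((‖u‖ ^ 2 + ‖v‖ ^ 2) ^ 2 : ℝ) * (conj (isoDot u v y) * isoVec u v k)).re := by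
  have hp := h.pos
  have hI := Complex.I_sq
  have hy' : (m 0 * y 0 + m 1 * y 1 + m 2 * y 2 : ℂ) = 0 := by
    rw [PiLp.inner_apply] at hy
    simp only [Fin.sum_univ_three] at hy
    simp at hy
    have : m 0 * y 0 + m 1 * y 1 + m 2 * y 2 = 0 := by linarith
    rw [← Complex.ofReal_mul, ← Complex.ofReal_mul, ← Complex.ofReal_mul, ← Complex.ofReal_add,
      ← Complex.ofReal_add, this, Complex.ofReal_zero]
  have E : (y 0 + y 1 * Complex.I) * conj u * v + (y 0 - y 1 * Complex.I) * u * conj v +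
      y 2 * (u * conj u - v * conj v) = 0 := by
    linear_combination (u * conj u + v * conj v) * hy' -
      (y 0 - y 1 * Complex.I) / 2 * h.xy - (y 0 + y 1 * Complex.I) / 2 * h.xy_conj -
      y 2 * h.z - (u * conj u + v * conj v) * m 1 * y 1 * hI
  have hc : conj (isoDot u v y) = ((y 0 - y 1 * Complex.I) * conj v ^ 2 -
      (y 0 + y 1 * Complex.I) * conj u ^ 2) / 2 + y 2 * (conj u * conj v) := by
    rw [isoDot_eq]; simp only [map_add, map_sub, map_mul, map_div₀, map_pow, map_ofNat,
      Complex.conj_ofReal, Complex.conj_I]; ring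
  -- The isotropic vector, its conjugate and `m` are mutually orthogonal in the Hermitian sense, and
  -- the isotropic vector has squared length `D² / 2`. This is the expansion of `y` in that basis;
  -- its `m`-component is the multiple of `E` that gets removed.
  have key : ((‖u‖ ^ 2 + ‖v‖ ^ 2) ^ 2 : ℝ) * (y k : ℂ) =
      2 * (conj (isoDot u v y) * isoVec u v k + isoDot u v y * conj (isoVec u v k)) := by
    have e := sq_norm_eq_mul_conj u v
    push_cast at e ⊢
    rw [e, hc, isoDot_eq]
    fin_cases k <;> simp [isoVec, map_ofNat]
    · linear_combination (u * conj v + conj u * v) * E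
    · linear_combination -(u * conj v - conj u * v) * Complex.I * E +
        y 1 * (u * conj u + v * conj v) ^ 2 * hI
    · linear_combination (u * conj u - v * conj v) * E
  have e2 : 2 * (conj (isoDot u v y) * isoVec u v k + isoDot u v y * conj (isoVec u v k)) =
      ((4 * (conj (isoDot u v y) * isoVec u v k).re : ℝ) : ℂ) := by
    have := Complex.add_conj (conj (isoDot u v y) * isoVec u v k)
    rw [map_mul, Complex.conj_conj] at this
    rw [this]; push_cast; ring
  rw [e2] at key
  have key' : (‖u‖ ^ 2 + ‖v‖ ^ 2) ^ 2 * y k = 4 * (conj (isoDot u v y) * isoVec u v k).re := by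
    exact_mod_cast key
  rw [show (4 / ((‖u‖ ^ 2 + ‖v‖ ^ 2) ^ 2 : ℝ) : ℂ) = ((4 / (‖u‖ ^ 2 + ‖v‖ ^ 2) ^ 2 : ℝ) : ℂ) by
    push_cast; ring, Complex.re_ofReal_mul]
  field_simp
  linarith

/-- Pairing with the isotropic vector is a similarity from the tangent plane of the sphere to `ℂ`.
Tangency of one of the two vectors suffices, since the expansion of `recover` is applied to that one
only. -/
theorem inner_eq (h : IsLift u v m) {y z : E3} (hy : inner ℝ m y = 0) :
    (‖u‖ ^ 2 + ‖v‖ ^ 2) ^ 2 * inner ℝ y z = 4 * (conj (isoDot u v y) * isoDot u v z).re := by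
  have hp := h.pos
  have e : inner ℝ y z = ∑ k, z k * y k := by
    rw [PiLp.inner_apply]; exact Finset.sum_congr rfl fun k _ => by simp
  have e' : (conj (isoDot u v y) * isoDot u v z).re =
      ∑ k, z k * (conj (isoDot u v y) * isoVec u v k).re := by
    rw [show isoDot u v z = ∑ k, (z k : ℂ) * isoVec u v k from rfl, Finset.mul_sum, Complex.re_sum]
    refine Finset.sum_congr rfl fun k _ => ?_
    rw [mul_left_comm, Complex.re_ofReal_mul]
  rw [e, e', Finset.mul_sum, Finset.mul_sum]
  refine Finset.sum_congr rfl fun k _ => ?_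
  conv_lhs => rw [h.recover hy k]
  rw [show (4 / ((‖u‖ ^ 2 + ‖v‖ ^ 2) ^ 2 : ℝ) : ℂ) = ((4 / (‖u‖ ^ 2 + ‖v‖ ^ 2) ^ 2 : ℝ) : ℂ) by
    push_cast; ring, Complex.re_ofReal_mul]
  field_simp

/-- Homogeneous coordinates are unique up to a factor. -/
theorem exists_smul (h : IsLift u v m) {u' v' : ℂ} (h' : IsLift u' v' m) :
    ∃ c : ℂ, c ≠ 0 ∧ u' = c * u ∧ v' = c * v := by
  have e1 : (u * conj u + v * conj v) * (1 + m 2) = 2 * u * conj u := by linear_combination h.z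
  have e2 : (u * conj u + v * conj v) * (1 - m 2) = 2 * v * conj v := by linear_combination -h.z
  -- A lift is fixed by the Hermitian projection onto the line determined by `m`. The factor sought
  -- is then the Hermitian product of the two lifts divided by `D`.
  have h1 : (1 + m 2 : ℂ) * u' + (m 0 + m 1 * Complex.I) * v' = 2 * u' := by
    apply mul_left_cancel₀ h'.ne
    linear_combination v' * h'.xy + u' * h'.z
  have h2 : (m 0 - m 1 * Complex.I : ℂ) * u' + (1 - m 2) * v' = 2 * v' := by
    apply mul_left_cancel₀ h'.ne
    linear_combination u' * h'.xy_conj - v' * h'.z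
  have hu : u' = (conj u * u' + conj v * v') / (u * conj u + v * conj v) * u := by
    rw [div_mul_eq_mul_div, eq_div_iff h.ne]
    linear_combination -(u * conj u + v * conj v) / 2 * h1 + u' / 2 * e1 + v' / 2 * h.xy
  have hv : v' = (conj u * u' + conj v * v') / (u * conj u + v * conj v) * v := by
    rw [div_mul_eq_mul_div, eq_div_iff h.ne]
    linear_combination -(u * conj u + v * conj v) / 2 * h2 + v' / 2 * e2 + u' / 2 * h.xy_conj
  refine ⟨_, fun h0 => ?_, hu, hv⟩
  rw [h0, zero_mul] at hu hv
  rcases h'.ne_zero with h3 | h3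
  exacts [h3 hu, h3 hv]

end IsLift

/-! ### Smooth local lifts by Hermitian projection -/

/-- The first coordinate of the projection of `(u, v)` to the line of the homogeneous coordinates
of `m`. -/
def projFst (u v : ℂ) (m : E3) : ℂ := ((1 + m 2) * u + (m 0 + m 1 * Complex.I) * v) / 2

/-- The second coordinate of the projection of `(u, v)` to the line of the homogeneous coordinates
of `m`. -/
def projSnd (u v : ℂ) (m : E3) : ℂ := ((m 0 - m 1 * Complex.I) * u + (1 - m 2) * v) / 2

theorem sum_sq_of_norm_eq_one {m : E3} (hm : ‖m‖ = 1) : m 0 ^ 2 + m 1 ^ 2 + m 2 ^ 2 = 1 := by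
  have := EuclideanSpace.norm_sq_eq m
  rw [hm, Fin.sum_univ_three] at this
  simp at this
  linarith

theorem IsLift.proj_self {u v : ℂ} {m : E3} (h : IsLift u v m) :
    projFst u v m = u ∧ projSnd u v m = v := by
  constructor
  · apply mul_left_cancel₀ h.ne
    rw [projFst]
    linear_combination v / 2 * h.xy + u / 2 * h.z
  · apply mul_left_cancel₀ h.ne
    rw [projSnd]
    linear_combination u / 2 * h.xy_conj - v / 2 * h.z

/-- For a unit vector `m` the matrix behind `projFst`, `projSnd` is a rank-one Hermitian projection,
and the projected vector has squared length `D (1 + ⟨m₀, m⟩) / 2`, nonzero unless `m` is antipodal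
to `m₀`. The projection being affine in `m`, a smooth unit field thereby gets a smooth lift near any
point. -/
theorem IsLift.proj {u v : ℂ} {m₀ m : E3} (h : IsLift u v m₀) (hm : ‖m‖ = 1)
    (hne : inner ℝ m₀ m ≠ -1) : IsLift (projFst u v m) (projSnd u v m) m := by
  have hI := Complex.I_sq
  have hs : ((m 0 : ℂ) + m 1 * Complex.I) * (m 0 - m 1 * Complex.I) + m 2 ^ 2 = 1 := by
    have := congrArg (fun r : ℝ => (r : ℂ)) (sum_sq_of_norm_eq_one hm)
    push_cast at this
    linear_combination this - (m 1 : ℂ) ^ 2 * hI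
  have hin : (inner ℝ m₀ m : ℝ) = m₀ 0 * m 0 + m₀ 1 * m 1 + m₀ 2 * m 2 := by
    rw [PiLp.inner_apply, Fin.sum_univ_three]; simp; ring
  have cu : conj (projFst u v m) =
      ((1 + m 2) * conj u + (m 0 - m 1 * Complex.I) * conj v) / 2 := by
    rw [projFst]; simp only [map_add, map_mul, map_div₀, map_ofNat,
      Complex.conj_ofReal, Complex.conj_I, map_one]; ring
  have cv : conj (projSnd u v m) =
      ((m 0 + m 1 * Complex.I) * conj u + (1 - m 2) * conj v) / 2 := by
    rw [projSnd]; simp only [map_add, map_sub, map_mul, map_div₀, map_ofNat,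
      Complex.conj_ofReal, Complex.conj_I, map_one]; ring
  have hD : projFst u v m * conj (projFst u v m) + projSnd u v m * conj (projSnd u v m) =
      ((1 + m 2) * u * conj u + (m 0 + m 1 * Complex.I) * conj u * v +
        (m 0 - m 1 * Complex.I) * u * conj v + (1 - m 2) * v * conj v) / 2 := by
    rw [cu, cv, projFst, projSnd]
    linear_combination (u * conj u + v * conj v) / 4 * hs
  refine ⟨?_, ?_, ?_⟩
  · have : projFst u v m * conj (projFst u v m) + projSnd u v m * conj (projSnd u v m) =
        (u * conj u + v * conj v) * ((1 + inner ℝ m₀ m : ℝ) : ℂ) / 2 := by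
      rw [hD, hin]; push_cast
      linear_combination -(m 0 - m 1 * Complex.I) / 4 * h.xy -
        (m 0 + m 1 * Complex.I) / 4 * h.xy_conj - m 2 / 2 * h.z -
        (u * conj u + v * conj v) * m₀ 1 * m 1 / 2 * hI
    rw [this]
    refine div_ne_zero (mul_ne_zero h.ne ?_) two_ne_zero
    exact_mod_cast fun h0 => hne (by linarith)
  · rw [hD, cv, projFst]
    linear_combination u * conj v / 2 * hs
  · rw [hD, cu, cv, projFst, projSnd]
    linear_combination (u * conj u - v * conj v) / 4 * hs

theorem exists_isLift {m : E3} (hm : ‖m‖ = 1) : ∃ u v, IsLift u v m := by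
  have h1 : IsLift 1 0 (sphereOf 1 0) := isLift_sphereOf (Or.inl one_ne_zero)
  have h2 : IsLift 0 1 (sphereOf 0 1) := isLift_sphereOf (Or.inr one_ne_zero)
  by_cases h : m 2 = -1
  · refine ⟨_, _, h2.proj hm ?_⟩
    rw [PiLp.inner_apply, Fin.sum_univ_three]
    simp [sphereOf, h]; norm_num
  · refine ⟨_, _, h1.proj hm ?_⟩
    rw [PiLp.inner_apply, Fin.sum_univ_three]
    simpa [sphereOf] using h

/-- The derivative of homogeneous coordinates of a curve on the sphere. -/
theorem isoDot_deriv {u v : ℝ → ℂ} {m : ℝ → E3} {u' v' : ℂ} {m' : E3} {t : ℝ}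
    (hu : HasDerivAt u u' t) (hv : HasDerivAt v v' t) (hm : HasDerivAt m m' t)
    (h : ∀ᶠ s in nhds t, IsLift (u s) (v s) (m s)) :
    isoDot (u t) (v t) m' = v t * u' - u t * v' := by
  have hcu : HasDerivAt (fun s => conj (u s)) (conj u') t := hu.star
  have hcv : HasDerivAt (fun s => conj (v s)) (conj v') t := hv.star
  have hk : ∀ k, HasDerivAt (fun s => ((m s k : ℝ) : ℂ)) (m' k) t := fun k =>
    ((hasDerivAt_pi.1 ((PiLp.hasStrictFDerivAt_ofLp 2 (m t)).hasFDerivAt.comp_hasDerivAt t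
      hm)) k).ofReal_comp
  have hD := (hu.mul hcu).add (hv.mul hcv)
  have e1 := (hD.mul ((hk 0).add ((hk 1).mul_const Complex.I))).unique
    (((hu.const_mul 2).mul hcv).congr_of_eventuallyEq (h.mono fun s hs => hs.xy))
  have e2 := (hD.mul ((hk 0).sub ((hk 1).mul_const Complex.I))).unique
    (((hcu.const_mul 2).mul hv).congr_of_eventuallyEq (h.mono fun s hs => hs.xy_conj))
  have e3 := (hD.mul (hk 2)).unique
    (((hu.mul hcu).sub (hv.mul hcv)).congr_of_eventuallyEq (h.mono fun s hs => hs.z))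
  have h0 := h.self_of_nhds
  -- Two factors `D` are needed: one to use the differentiated equations, and one to eliminate the
  -- terms in the derivative of `D` by the undifferentiated ones.
  apply mul_left_cancel₀ h0.ne
  rw [isoDot_eq]
  simp only [Pi.add_apply, Pi.mul_apply, Pi.sub_apply] at e1 e2 e3
  apply mul_left_cancel₀ h0.ne
  linear_combination (u t * conj (u t) + v t * conj (v t)) *
    (v t ^ 2 / 2 * e1 - u t ^ 2 / 2 * e2 + u t * v t * e3) -
    (u' * conj (u t) + u t * conj u' + (v' * conj (v t) + v t * conj v')) *
    (v t ^ 2 / 2 * h0.xy - u t ^ 2 / 2 * h0.xy_conj + u t * v t * h0.z)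

theorem isoVec_smul (c u v : ℂ) (k : Fin 3) : isoVec (c * u) (c * v) k = c ^ 2 * isoVec u v k := by
  fin_cases k <;> simp [isoVec] <;> ring

theorem isoDot_mul (c u v : ℂ) (y : E3) : isoDot (c * u) (c * v) y = c ^ 2 * isoDot u v y := by
  simp only [isoDot, isoVec_smul, Finset.mul_sum]
  exact Finset.sum_congr rfl fun k _ => by ring

theorem IsLift.isoDot_ne_zero {u v : ℂ} {m y : E3} (h : IsLift u v m) (hy : inner ℝ m y = 0)
    (h0 : y ≠ 0) : isoDot u v y ≠ 0 := by
  intro hc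
  apply h0
  ext k
  rw [h.recover hy k, hc]; simp

theorem IsLift.pow_four_ne_iff {u v : ℂ} {m : E3} (h : IsLift u v m) :
    u ^ 4 ≠ v ^ 4 ↔ (1 - m 0 ^ 2) * (1 - m 1 ^ 2) ≠ 0 := by
  have hp := h.pos
  have := h.pow_four_normSq
  rw [← sub_ne_zero, ← norm_ne_zero_iff, ← pow_ne_zero_iff two_ne_zero, this, mul_ne_zero_iff]
  exact ⟨fun h => h.2, fun h => ⟨by positivity, h⟩⟩

/-! ### The phase at a point and its symmetries -/

/-- The vector `L` is the value `Re (h ω(N))` of the real part of a multiple of the Weierstrass form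
of Scherk's surface, at the point `m` of the sphere and the tangent vector `N`. -/
def HasPhase (h : ℂ) (m N L : E3) : Prop :=
  ∃ u v, IsLift u v m ∧
    ∀ k, L k = (h * (isoVec u v k * (isoDot u v N / (u ^ 4 - v ^ 4)))).re

namespace HasPhase

variable {h h' : ℂ} {m N L : E3}

/-- Rescaling the lift by `c` multiplies the isotropic vector and the pairing by `c²` each and the
denominator by `c⁴`, so the form depends on `m` alone. -/
theorem eq_of_isLift (H : HasPhase h m N L) {u v : ℂ} (hl : IsLift u v m) (k : Fin 3) :
    L k = (h * (isoVec u v k * (isoDot u v N / (u ^ 4 - v ^ 4)))).re := by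
  obtain ⟨u', v', hl', hL⟩ := H
  obtain ⟨c, hc, rfl, rfl⟩ := hl.exists_smul hl'
  rw [hL, isoVec_smul, isoDot_mul, show (c * u) ^ 4 - (c * v) ^ 4 = c ^ 4 * (u ^ 4 - v ^ 4) by ring]
  congr 2
  -- At a puncture both quotients are `0` by the convention for division by zero.
  by_cases h0 : u ^ 4 - v ^ 4 = 0
  · simp [h0]
  · field_simp

theorem unique (H : HasPhase h m N L) (H' : HasPhase h' m N L) (hN : inner ℝ m N = 0)
    (h0 : N ≠ 0) (hr : (1 - m 0 ^ 2) * (1 - m 1 ^ 2) ≠ 0) : h = h' := by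
  obtain ⟨u, v, hl, hL⟩ := H
  have hq := hl.isoDot_ne_zero hN h0
  have h4 := sub_ne_zero.2 (hl.pow_four_ne_iff.2 hr)
  have : (h - h') * (isoDot u v N / (u ^ 4 - v ^ 4)) = 0 := by
    apply eq_zero_of_re_mul_isoVec hl.ne_zero
    intro k
    have e1 := hL k
    rw [H'.eq_of_isLift hl k, ← sub_eq_zero, ← Complex.sub_re] at e1
    rw [← neg_eq_zero, ← Complex.neg_re, ← e1]
    congr 1; ring
  rw [mul_eq_zero, or_iff_left (div_ne_zero hq h4)] at this
  exact sub_eq_zero.1 this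

end HasPhase

/-- The exchange of the first two coordinates. -/
def swapIso : E3 ≃ₗᵢ[ℝ] E3 := LinearIsometryEquiv.piLpCongrLeft 2 ℝ ℝ (Equiv.swap 0 1)

/-- The reflection of the second coordinate. -/
def reflIso : E3 ≃ₗᵢ[ℝ] E3 := LinearIsometryEquiv.piLpCongrRight 2 fun i : Fin 3 =>
  if i = 1 then LinearIsometryEquiv.neg ℝ else LinearIsometryEquiv.refl ℝ ℝ

theorem swapIso_apply (x : E3) : swapIso x 0 = x 1 ∧ swapIso x 1 = x 0 ∧ swapIso x 2 = x 2 := by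
  refine ⟨?_, ?_, ?_⟩ <;>
    simp [swapIso, LinearIsometryEquiv.piLpCongrLeft_apply, Equiv.piCongrLeft',
      Equiv.swap_apply_def]

theorem reflIso_apply (x : E3) : reflIso x 0 = x 0 ∧ reflIso x 1 = -x 1 ∧ reflIso x 2 = x 2 := by
  refine ⟨?_, ?_, ?_⟩ <;> simp [reflIso, LinearIsometryEquiv.piLpCongrRight_apply]

/-- The reflection acts on the sphere as `z ↦ conj z`, which conjugates all the data up to the sign
of the reflected coordinate. -/
theorem HasPhase.reflIso {h : ℂ} {m N L : E3} (H : HasPhase h m N L) :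
    HasPhase (conj h) (reflIso m) (reflIso N) (reflIso L) := by
  obtain ⟨u, v, hl, hL⟩ := H
  obtain ⟨m0, m1, m2⟩ := reflIso_apply m
  obtain ⟨n0, n1, n2⟩ := reflIso_apply N
  obtain ⟨l0, l1, l2⟩ := reflIso_apply L
  have hd : isoDot (conj u) (conj v) (_root_.reflIso N) = conj (isoDot u v N) := by
    rw [isoDot_eq, isoDot_eq, n0, n1, n2]
    simp only [map_add, map_sub, map_mul, map_div₀, map_pow, map_ofNat,
      Complex.conj_ofReal, Complex.conj_I, Complex.ofReal_neg]
    ring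
  refine ⟨conj u, conj v, ⟨?_, ?_, ?_⟩, ?_⟩
  · have := hl.ne
    simp only [Complex.conj_conj]
    rwa [mul_comm (conj u), mul_comm (conj v)]
  · rw [m0, m1]; simp only [Complex.conj_conj]; push_cast
    linear_combination hl.xy_conj
  · rw [m2]; simp only [Complex.conj_conj]
    linear_combination hl.z
  · have hk : ∀ k (c : ℂ), isoVec (conj u) (conj v) k = c * conj (isoVec u v k) → conj c = c →
        conj h * (isoVec (conj u) (conj v) k * (isoDot (conj u) (conj v) (_root_.reflIso N) /
          (conj u ^ 4 - conj v ^ 4))) =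
        conj (c * (h * (isoVec u v k * (isoDot u v N / (u ^ 4 - v ^ 4))))) := by
      intro k c e hc
      rw [e, hd]
      simp only [map_mul, map_div₀, map_sub, map_pow, hc]
      ring
    intro k
    fin_cases k <;> simp only [Fin.zero_eta, Fin.mk_one, Fin.reduceFinMk]
    · rw [l0, hL, hk 0 1 (by simp [isoVec, map_ofNat]) (by simp), Complex.conj_re, one_mul]
    · rw [l1, hL, hk 1 (-1) (by simp [isoVec, map_ofNat]; ring) (by simp), Complex.conj_re,
        neg_one_mul, Complex.neg_re]
    · rw [l2, hL, hk 2 1 (by simp [isoVec]) (by simp), Complex.conj_re, one_mul]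

/-- The exchange acts on the sphere as `z ↦ i conj z`. The isotropic vector and the pairing each
acquire a factor `i` besides the conjugation, whence the minus sign. -/
theorem HasPhase.swapIso {h : ℂ} {m N L : E3} (H : HasPhase h m N L) :
    HasPhase (-conj h) (swapIso m) (swapIso N) (swapIso L) := by
  obtain ⟨u, v, hl, hL⟩ := H
  have hI := Complex.I_sq
  obtain ⟨m0, m1, m2⟩ := swapIso_apply m
  obtain ⟨n0, n1, n2⟩ := swapIso_apply N
  obtain ⟨l0, l1, l2⟩ := swapIso_apply L
  have hd : isoDot (Complex.I * conj u) (conj v) (_root_.swapIso N) =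
      Complex.I * conj (isoDot u v N) := by
    rw [isoDot_eq, isoDot_eq, n0, n1, n2]
    simp only [map_add, map_sub, map_mul, map_div₀, map_pow, map_ofNat,
      Complex.conj_ofReal, Complex.conj_I]
    linear_combination ((N 1 : ℂ) * (conj v ^ 2) / 2 +
      (N 0 : ℂ) * conj u ^ 2 * Complex.I / 2) * hI
  have h4 : (Complex.I * conj u) ^ 4 - conj v ^ 4 = conj (u ^ 4 - v ^ 4) := by
    simp only [map_sub, map_pow]; rw [mul_pow, Complex.I_pow_four, one_mul]
  refine ⟨Complex.I * conj u, conj v, ⟨?_, ?_, ?_⟩, ?_⟩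
  · have := hl.ne
    simp only [map_mul, Complex.conj_conj, Complex.conj_I]
    contrapose! this
    linear_combination this + u * conj u * hI
  · rw [m0, m1]; simp only [map_mul, Complex.conj_conj, Complex.conj_I]
    linear_combination Complex.I * hl.xy_conj + ((u * conj u + v * conj v) * m 1 -
      u * conj u * (m 1 + m 0 * Complex.I)) * hI
  · rw [m2]; simp only [map_mul, Complex.conj_conj, Complex.conj_I]
    linear_combination hl.z - (u * conj u * m 2 - u * conj u) * hI
  · have hk : ∀ k j, isoVec (Complex.I * conj u) (conj v) k = Complex.I * conj (isoVec u v j) →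
        -conj h * (isoVec (Complex.I * conj u) (conj v) k *
          (isoDot (Complex.I * conj u) (conj v) (_root_.swapIso N) /
          ((Complex.I * conj u) ^ 4 - conj v ^ 4))) =
        conj (h * (isoVec u v j * (isoDot u v N / (u ^ 4 - v ^ 4)))) := by
      intro k j e
      rw [e, hd, h4]
      simp only [map_mul, map_div₀]
      linear_combination -(conj h * conj (isoVec u v j) * conj (isoDot u v N) /
        conj (u ^ 4 - v ^ 4)) * hI
    intro k
    fin_cases k <;> simp only [Fin.zero_eta, Fin.mk_one, Fin.reduceFinMk]
    · rw [l0, hL, hk 0 1, Complex.conj_re]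
      simp [isoVec, map_ofNat]
      linear_combination (-(conj u ^ 2) / 2 + (conj u ^ 2 + conj v ^ 2) / 2) * hI
    · rw [l1, hL, hk 1 0, Complex.conj_re]
      simp [isoVec, map_ofNat]
      linear_combination Complex.I * conj u ^ 2 / 2 * hI
    · rw [l2, hL, hk 2 2, Complex.conj_re]
      simp [isoVec]; ring

/-- For a symmetric traceless shape operator `(a, b; c, -a)`, the differential of the position is a
complex multiple of the conjugate differential of the normal. -/
theorem IsLift.exists_weierstrass {u v : ℂ} {m Xs Xt Ns Nt : E3} {a b c : ℝ} (h : IsLift u v m)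
    (hs : inner ℝ m Xs = 0) (ht : inner ℝ m Xt = 0)
    (es : Ns = -(a • Xs + c • Xt)) (et : Nt = -(b • Xs - a • Xt))
    (hsym : inner ℝ Xs Nt = inner ℝ Xt Ns) (h0 : Ns ≠ 0) :
    ∃ g : ℂ, g = conj (isoDot u v Xs) / isoDot u v Ns ∧
      conj (isoDot u v Xs) = g * isoDot u v Ns ∧ conj (isoDot u v Xt) = g * isoDot u v Nt ∧
      ‖g‖ ^ 2 * (a ^ 2 + b * c) = 1 := by
  have hNs : inner ℝ m Ns = 0 := by
    rw [es, inner_neg_right, inner_add_right, inner_smul_right, inner_smul_right, hs, ht]; simp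
  have hq := h.isoDot_ne_zero hNs h0
  have i1 := h.inner_eq (z := Nt) hs
  have i2 := h.inner_eq (z := Ns) ht
  rw [hsym, i2] at i1
  have hneg : ∀ y : E3, isoDot u v (-y) = -isoDot u v y := fun y => by
    rw [← neg_one_smul ℝ, isoDot_smul]; push_cast; ring
  have hsub : ∀ y z : E3, isoDot u v (y - z) = isoDot u v y - isoDot u v z := fun y z => by
    rw [sub_eq_add_neg, isoDot_add, hneg, sub_eq_add_neg]
  have qs : isoDot u v Ns = -(a * isoDot u v Xs + c * isoDot u v Xt) := by
    rw [es, hneg, isoDot_add, isoDot_smul, isoDot_smul]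
  have qt : isoDot u v Nt = -(b * isoDot u v Xs - a * isoDot u v Xt) := by
    rw [et, hneg, hsub, isoDot_smul, isoDot_smul]
  -- The real parts agree by symmetry of the second fundamental form, the imaginary parts by
  -- vanishing of the trace.
  have key : conj (isoDot u v Xs) * isoDot u v Nt = conj (isoDot u v Xt) * isoDot u v Ns := by
    apply Complex.ext
    · linarith
    · rw [qs, qt]
      simp
      ring
  generalize isoDot u v Xs = ps at *
  generalize isoDot u v Xt = pt at *
  generalize isoDot u v Ns = Qs at *
  generalize isoDot u v Nt = Qt at *
  have k1 : conj ps = conj ps / Qs * Qs := by field_simp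
  have k2 : conj pt = conj ps / Qs * Qt := by field_simp; exact key.symm
  refine ⟨_, rfl, k1, k2, ?_⟩
  set g := conj ps / Qs
  have c1 : ps = conj g * conj Qs := by rw [← map_mul, ← k1, Complex.conj_conj]
  have c2 : pt = conj g * conj Qt := by rw [← map_mul, ← k2, Complex.conj_conj]
  have d1 : conj Qs = -(a * conj ps + c * conj pt) := by rw [qs]; simp
  have d2 : conj Qt = -(b * conj ps - a * conj pt) := by rw [qt]; simp
  -- A traceless `2 × 2` matrix squares to `a² + b c` times the identity; applying the relation
  -- between the two differentials twice brings in `|g|²`.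
  have e : (g * conj g * (a ^ 2 + b * c)) * Qs = 1 * Qs := by
    rw [k1, k2] at d1 d2
    rw [c1, c2, d1, d2] at qs
    linear_combination -qs
  have e' := mul_right_cancel₀ hq e
  rw [Complex.mul_conj, Complex.normSq_eq_norm_sq] at e'
  exact_mod_cast e'

/-! ### Potentials and closedness of the Weierstrass form -/

section Potential

variable {E : Type*} [NormedAddCommGroup E] [NormedSpace ℝ E]

/-- Dividing by `f x` moves the value at `x` to `1`, inside the domain of the principal logarithm,
and leaves the logarithmic derivative unchanged. -/
theorem exists_log_potential {f : E → ℂ} {x : E} (hf : ContDiffAt ℝ 2 f x) (h0 : f x ≠ 0) :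
    ∃ l : E → ℂ, ContDiffAt ℝ 2 l x ∧
      ∀ᶠ y in nhds x, HasFDerivAt l ((f y)⁻¹ • fderiv ℝ f y) y := by
  have h1 : f x / f x ∈ Complex.slitPlane := by rw [div_self h0]; exact Complex.one_mem_slitPlane
  have hd : ContDiffAt ℝ 2 (fun y => f y / f x) x := hf.div_const _
  refine ⟨fun y => Complex.log (f y / f x),
    ContDiffAt.comp (g := Complex.log) x ((Complex.contDiffAt_log h1).restrict_scalars ℝ) hd, ?_⟩
  have e1 : ∀ᶠ y in nhds x, f y / f x ∈ Complex.slitPlane :=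
    hd.continuousAt.eventually (Complex.isOpen_slitPlane.mem_nhds h1)
  have e2 : ∀ᶠ y in nhds x, DifferentiableAt ℝ f y :=
    (hf.eventually (by simp)).mono fun y hy => hy.differentiableAt (by simp)
  have e3 : ∀ᶠ y in nhds x, f y ≠ 0 := hf.continuousAt.eventually_ne h0
  filter_upwards [e1, e2, e3] with y h1 h2 h3
  have hg : HasFDerivAt (fun y => f y / f x) ((f x)⁻¹ • fderiv ℝ f y) y := by
    simpa [div_eq_inv_mul] using h2.hasFDerivAt.const_mul (f x)⁻¹
  have := (((Complex.hasStrictDerivAt_log h1).hasDerivAt).hasFDerivAt.restrictScalars ℝ).comp y hg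
  refine this.congr_fderiv ?_
  ext a
  simp
  field_simp

/-- Local potentials of the Weierstrass form of Scherk's surface. -/
theorem exists_scherk_potential {u v : E → ℂ} {x : E} (hu : ContDiffAt ℝ 2 u x)
    (hv : ContDiffAt ℝ 2 v x) (h4 : u x ^ 4 ≠ v x ^ 4) (k : Fin 3) :
    ∃ l : E → ℂ, ContDiffAt ℝ 2 l x ∧ ∀ᶠ y in nhds x, ∀ a, fderiv ℝ l y a =
      isoVec (u y) (v y) k *
        ((v y * fderiv ℝ u y a - u y * fderiv ℝ v y a) / (u y ^ 4 - v y ^ 4)) := by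
  have hI := Complex.I_sq
  have hfac : ∀ y, u y ^ 4 ≠ v y ^ 4 → v y - u y ≠ 0 ∧ v y + u y ≠ 0 ∧
      v y - Complex.I * u y ≠ 0 ∧ v y + Complex.I * u y ≠ 0 := by
    intro y hy
    have h4 : v y ^ 4 - u y ^ 4 ≠ 0 := sub_ne_zero.2 hy.symm
    rw [scherk_factor] at h4
    simp only [mul_ne_zero_iff] at h4
    tauto
  obtain ⟨h1, h2, h3, h5⟩ := hfac x h4
  have hd : ∀ᶠ y in nhds x, DifferentiableAt ℝ u y ∧ DifferentiableAt ℝ v y ∧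
      u y ^ 4 ≠ v y ^ 4 := by
    have e1 := (hu.eventually (by simp)).mono fun y hy => hy.differentiableAt (by simp)
    have e2 := (hv.eventually (by simp)).mono fun y hy => hy.differentiableAt (by simp)
    have e3 : ∀ᶠ y in nhds x, u y ^ 4 - v y ^ 4 ≠ 0 :=
      ((hu.continuousAt.pow 4).sub (hv.continuousAt.pow 4)).eventually_ne (sub_ne_zero.2 h4)
    filter_upwards [e1, e2, e3] with y a b c using ⟨a, b, sub_ne_zero.1 c⟩
  -- Partial fractions: each component of the form is a constant combination of the logarithmic
  -- differentials of the four linear factors of `v⁴ - u⁴`.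
  obtain ⟨a, ca, da⟩ := exists_log_potential (hv.sub hu) h1
  obtain ⟨b, cb, db⟩ := exists_log_potential (hv.add hu) h2
  obtain ⟨c, cc, dc⟩ := exists_log_potential (hv.sub (contDiffAt_const (c := Complex.I).mul hu)) h3
  obtain ⟨d, cd, dd⟩ := exists_log_potential (hv.add (contDiffAt_const (c := Complex.I).mul hu)) h5
  have hall : ∀ᶠ y in nhds x, (u y ^ 4 ≠ v y ^ 4) ∧ ∀ w,
      (∃ a' : E →L[ℝ] ℂ, HasFDerivAt a a' y ∧
        a' w = (fderiv ℝ v y w - fderiv ℝ u y w) / (v y - u y)) ∧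
      (∃ a' : E →L[ℝ] ℂ, HasFDerivAt b a' y ∧
        a' w = (fderiv ℝ v y w + fderiv ℝ u y w) / (v y + u y)) ∧
      (∃ a' : E →L[ℝ] ℂ, HasFDerivAt c a' y ∧ a' w = (fderiv ℝ v y w - Complex.I * fderiv ℝ u y w) /
        (v y - Complex.I * u y)) ∧
      (∃ a' : E →L[ℝ] ℂ, HasFDerivAt d a' y ∧ a' w = (fderiv ℝ v y w + Complex.I * fderiv ℝ u y w) /
        (v y + Complex.I * u y)) := by
    filter_upwards [hd, da, db, dc, dd] with y ⟨q1, q2, q3⟩ ra rb rc rd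
    have q4 := (q1.hasFDerivAt.const_mul Complex.I)
    refine ⟨q3, fun w => ⟨⟨_, ra, ?_⟩, ⟨_, rb, ?_⟩, ⟨_, rc, ?_⟩, ⟨_, rd, ?_⟩⟩⟩
    · rw [show fderiv ℝ (fun x => v x - u x) y = fderiv ℝ v y - fderiv ℝ u y from
        (q2.hasFDerivAt.sub q1.hasFDerivAt).fderiv]; simp; ring
    · rw [show fderiv ℝ (fun x => v x + u x) y = fderiv ℝ v y + fderiv ℝ u y from
        (q2.hasFDerivAt.add q1.hasFDerivAt).fderiv]; simp; ring
    · rw [show fderiv ℝ (fun x => v x - Complex.I * u x) y =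
        fderiv ℝ v y - Complex.I • fderiv ℝ u y from
        (q2.hasFDerivAt.sub q4).fderiv]; simp; ring
    · rw [show fderiv ℝ (fun x => v x + Complex.I * u x) y =
        fderiv ℝ v y + Complex.I • fderiv ℝ u y from
        (q2.hasFDerivAt.add q4).fderiv]; simp; ring
  have hpq : ∀ y, u y ^ 4 ≠ v y ^ 4 → v y ^ 2 + u y ^ 2 ≠ 0 := fun y hy h => by
    obtain ⟨p1, p2, p3, p4⟩ := hfac y hy
    apply mul_ne_zero p4 p3
    linear_combination h - u y ^ 2 * hI
  fin_cases k
  · refine ⟨fun y => Complex.I / 4 * (d y - c y), contDiffAt_const.mul (cd.sub cc), ?_⟩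
    filter_upwards [hall] with y ⟨hy, hw⟩ w
    obtain ⟨-, -, ⟨c', hc, ec⟩, ⟨d', hd, ed⟩⟩ := hw w
    rw [show fderiv ℝ (fun y => Complex.I / 4 * (d y - c y)) y = (Complex.I / 4) • (d' - c') from
      ((hd.sub hc).const_mul (Complex.I / 4)).fderiv]
    simp only [smul_apply, sub_apply, ec, ed, smul_eq_mul]
    obtain ⟨p1, p2, p3, p4⟩ := hfac y hy
    have e2 := hpq y hy
    simp only [isoVec, Fin.zero_eta, Matrix.cons_val_zero]
    rw [div_sub_div _ _ p4 p3, show (v y + Complex.I * u y) * (v y - Complex.I * u y) =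
      v y ^ 2 + u y ^ 2 by linear_combination -(u y ^ 2) * hI,
      show u y ^ 4 - v y ^ 4 = -((v y - u y) * (v y + u y) * (v y ^ 2 + u y ^ 2)) by ring]
    field_simp
    linear_combination -(v y ^ 2 - u y ^ 2) * (u y * fderiv ℝ v y w - v y * fderiv ℝ u y w) * 4 * hI
  · refine ⟨fun y => Complex.I / 4 * (a y - b y), contDiffAt_const.mul (ca.sub cb), ?_⟩
    filter_upwards [hall] with y ⟨hy, hw⟩ w
    obtain ⟨⟨c', hc, ec⟩, ⟨d', hd, ed⟩, -, -⟩ := hw w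
    rw [show fderiv ℝ (fun y => Complex.I / 4 * (a y - b y)) y = (Complex.I / 4) • (c' - d') from
      ((hc.sub hd).const_mul (Complex.I / 4)).fderiv]
    simp only [smul_apply, sub_apply, ec, ed, smul_eq_mul]
    obtain ⟨p1, p2, p3, p4⟩ := hfac y hy
    have e2 := hpq y hy
    simp only [isoVec, Fin.mk_one, Matrix.cons_val_one, Matrix.cons_val_zero]
    rw [show u y ^ 4 - v y ^ 4 = -((v y - u y) * (v y + u y) * (v y ^ 2 + u y ^ 2)) by ring]
    field_simp
    ring
  · refine ⟨fun y => 1 / 4 * ((a y + b y) - (c y + d y)),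
      contDiffAt_const.mul ((ca.add cb).sub (cc.add cd)), ?_⟩
    filter_upwards [hall] with y ⟨hy, hw⟩ w
    obtain ⟨⟨a', ha, ea⟩, ⟨b', hb, eb⟩, ⟨c', hc, ec⟩, ⟨d', hd, ed⟩⟩ := hw w
    rw [show fderiv ℝ (fun y => 1 / 4 * ((a y + b y) - (c y + d y))) y =
      (1 / 4 : ℂ) • ((a' + b') - (c' + d')) from
      (((ha.add hb).sub (hc.add hd)).const_mul (1 / 4)).fderiv]
    simp only [smul_apply, sub_apply,
      add_apply, ea, eb, ec, ed, smul_eq_mul]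
    obtain ⟨p1, p2, p3, p4⟩ := hfac y hy
    have e2 := hpq y hy
    simp only [isoVec, Fin.reduceFinMk, Matrix.cons_val]
    rw [div_add_div _ _ p1 p2, div_add_div _ _ p3 p4,
      show (v y - Complex.I * u y) * (v y + Complex.I * u y) =
        v y ^ 2 + u y ^ 2 by linear_combination -(u y ^ 2) * hI,
      show u y ^ 4 - v y ^ 4 = -((v y - u y) * (v y + u y) * (v y ^ 2 + u y ^ 2)) by ring]
    field_simp
    linear_combination (v y ^ 2 - u y ^ 2) * 2 * u y * fderiv ℝ u y w * hI

/-- If `dY = Re (h dl)` then `Re (dh ∧ dl) = 0`. -/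
theorem re_wedge_eq_zero {Y : E → ℝ} {h l : E → ℂ} {x : E} {h' : E →L[ℝ] ℂ}
    (hh : HasFDerivAt h h' x) (hl : ContDiffAt ℝ 2 l x)
    (hY : ∀ᶠ y in nhds x, HasFDerivAt Y (Complex.reCLM.comp (h y • fderiv ℝ l y)) y) (a b : E) :
    (h' a * fderiv ℝ l x b).re = (h' b * fderiv ℝ l x a).re := by
  have hl1 : ∀ᶠ y in nhds x, HasFDerivAt l (fderiv ℝ l y) y :=
    (hl.eventually (by simp)).mono fun y hy => (hy.differentiableAt (by simp)).hasFDerivAt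
  have hl2 : HasFDerivAt (fderiv ℝ l) (fderiv ℝ (fderiv ℝ l) x) x :=
    ((hl.fderiv_right (m := 1) (by norm_num)).differentiableAt (by simp)).hasFDerivAt
  have s1 := second_derivative_symmetric_of_eventually hl1 hl2 a b
  have hc := ((ContinuousLinearMap.compL ℝ E ℂ ℝ Complex.reCLM).hasFDerivAt.comp x (hh.smul hl2))
  have s2 := second_derivative_symmetric_of_eventually hY hc a b
  simp [s1] at s2
  simp
  linarith

end Potential

/-! ### Minimal surfaces in local coordinates and their phase functions -/

/-- The Euclidean plane. -/
abbrev E2 : Type := EuclideanSpace ℝ (Fin 2)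

/-- The coordinate vectors of the plane. -/
def planeVec (i : Fin 2) : E2 := EuclideanSpace.single i 1

theorem eq_planeVec (w : E2) : w = w 0 • planeVec 0 + w 1 • planeVec 1 := by
  ext i
  fin_cases i <;> simp [planeVec]

section Smooth

variable {E : Type*} [NormedAddCommGroup E] [NormedSpace ℝ E]

theorem two_le_infty : (2 : ℕ∞ω) ≤ ∞ := WithTop.coe_le_coe.2 (le_top : (2 : ℕ∞) ≤ ⊤)

theorem differentiableAt_fderiv {F : Type*} [NormedAddCommGroup F] [NormedSpace ℝ F] {f : E → F} {x : E}
    (hf : ContDiffAt ℝ ∞ f x) : DifferentiableAt ℝ (fderiv ℝ f) x :=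
  ((hf.of_le two_le_infty).fderiv_right (m := 1) (by norm_num)).differentiableAt (by simp)

theorem contDiffAt_coord {G : E → E3} {x : E} {n : ℕ∞ω} (hG : ContDiffAt ℝ n G x) (k : Fin 3) :
    ContDiffAt ℝ n (fun y => ((G y k : ℝ) : ℂ)) x :=
  Complex.ofRealCLM.contDiff.contDiffAt.comp x
    ((EuclideanSpace.proj k : E3 →L[ℝ] ℝ).contDiff.contDiffAt.comp x hG)

theorem contDiffAt_projFst {G : E → E3} {x : E} {n : ℕ∞ω} (hG : ContDiffAt ℝ n G x) (u v : ℂ) :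
    ContDiffAt ℝ n (fun y => projFst u v (G y)) x := by
  have h := contDiffAt_coord hG
  exact (((contDiffAt_const.add (h 2)).mul contDiffAt_const).add
    (((h 0).add ((h 1).mul contDiffAt_const)).mul contDiffAt_const)).div_const 2

theorem contDiffAt_projSnd {G : E → E3} {x : E} {n : ℕ∞ω} (hG : ContDiffAt ℝ n G x) (u v : ℂ) :
    ContDiffAt ℝ n (fun y => projSnd u v (G y)) x := by
  have h := contDiffAt_coord hG
  exact ((((h 0).sub ((h 1).mul contDiffAt_const)).mul contDiffAt_const).add
    ((contDiffAt_const.sub (h 2)).mul contDiffAt_const)).div_const 2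

theorem differentiableAt_isoDot {u v : E → ℂ} {G : E → E3} {x : E} (hu : DifferentiableAt ℝ u x)
    (hv : DifferentiableAt ℝ v x) (hG : DifferentiableAt ℝ G x) :
    DifferentiableAt ℝ (fun y => isoDot (u y) (v y) (G y)) x := by
  have h : ∀ k, DifferentiableAt ℝ (fun y => ((G y k : ℝ) : ℂ)) x := fun k =>
    Complex.ofRealCLM.differentiableAt.comp x
      ((EuclideanSpace.proj k : E3 →L[ℝ] ℝ).differentiableAt.comp x hG)
  have h0 := h 0
  have h1 := h 1
  have h2 := h 2
  simp only [isoDot_eq]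
  fun_prop

theorem differentiableAt_conj {f : E → ℂ} {x : E} (hf : DifferentiableAt ℝ f x) :
    DifferentiableAt ℝ (fun y => conj (f y)) x :=
  (Complex.conjCLE.toContinuousLinearMap.differentiableAt).comp x hf

theorem isoDot_fderiv {u v : E → ℂ} {m : E → E3} {x : E} (hu : DifferentiableAt ℝ u x)
    (hv : DifferentiableAt ℝ v x) (hm : DifferentiableAt ℝ m x)
    (h : ∀ᶠ y in nhds x, IsLift (u y) (v y) (m y)) (a : E) :
    isoDot (u x) (v x) (fderiv ℝ m x a) = v x * fderiv ℝ u x a - u x * fderiv ℝ v x a := by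
  have hl : HasDerivAt (fun t : ℝ => x + t • a) a 0 := by
    simpa using ((hasDerivAt_id (0 : ℝ)).smul_const a).const_add x
  have hx : x + (0 : ℝ) • a = x := by simp
  have hc : Filter.Tendsto (fun t : ℝ => x + t • a) (nhds 0) (nhds x) := by
    simpa using hl.continuousAt.tendsto
  have hu' : HasFDerivAt u (fderiv ℝ u x) (x + (0 : ℝ) • a) := by rw [hx]; exact hu.hasFDerivAt
  have hv' : HasFDerivAt v (fderiv ℝ v x) (x + (0 : ℝ) • a) := by rw [hx]; exact hv.hasFDerivAt
  have hm' : HasFDerivAt m (fderiv ℝ m x) (x + (0 : ℝ) • a) := by rw [hx]; exact hm.hasFDerivAt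
  have := isoDot_deriv (hu'.comp_hasDerivAt 0 hl) (hv'.comp_hasDerivAt 0 hl)
    (hm'.comp_hasDerivAt 0 hl) (hc.eventually h)
  simpa using this

end Smooth

/-- An oriented minimal surface `F` in local coordinates, with unit normal `m` and Gauss curvature
`K < 0`. -/
structure MinimalChart (O : Set E2) (F m : E2 → E3) (K : E2 → ℝ) : Prop where
  isOpen : IsOpen O
  smooth : ContDiffOn ℝ ∞ F O
  normal_smooth : ContDiffOn ℝ ∞ m O
  unit : ∀ x ∈ O, ‖m x‖ = 1
  orth : ∀ x ∈ O, ∀ w, inner ℝ (m x) (fderiv ℝ F x w) = 0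
  normal_inj : ∀ x ∈ O, Function.Injective (fderiv ℝ m x)
  weingarten : ∀ x ∈ O, ∃ a b c : ℝ,
    fderiv ℝ m x (planeVec 0) =
      -(a • fderiv ℝ F x (planeVec 0) + c • fderiv ℝ F x (planeVec 1)) ∧
    fderiv ℝ m x (planeVec 1) =
      -(b • fderiv ℝ F x (planeVec 0) - a • fderiv ℝ F x (planeVec 1)) ∧
    K x = -(a ^ 2 + b * c)
  neg : ∀ x ∈ O, K x < 0

namespace MinimalChart

variable {O : Set E2} {F m : E2 → E3} {K : E2 → ℝ}

theorem contDiffAt (h : MinimalChart O F m K) {x : E2} (hx : x ∈ O) : ContDiffAt ℝ ∞ F x :=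
  h.smooth.contDiffAt (h.isOpen.mem_nhds hx)

theorem normal_contDiffAt (h : MinimalChart O F m K) {x : E2} (hx : x ∈ O) :
    ContDiffAt ℝ ∞ m x :=
  h.normal_smooth.contDiffAt (h.isOpen.mem_nhds hx)

theorem normal_differentiableAt (h : MinimalChart O F m K) {x : E2} (hx : x ∈ O) :
    DifferentiableAt ℝ m x := (h.normal_contDiffAt hx).differentiableAt (by simp)

theorem normal_orth (h : MinimalChart O F m K) {x : E2} (hx : x ∈ O) (w : E2) :
    inner ℝ (m x) (fderiv ℝ m x w) = 0 := by
  have hd := (h.normal_differentiableAt hx).hasFDerivAt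
  have h1 := hd.inner ℝ hd
  have h2 : HasFDerivAt (fun y => inner ℝ (m y) (m y)) (0 : E2 →L[ℝ] ℝ) x := by
    refine (hasFDerivAt_const (1 : ℝ) x).congr_of_eventuallyEq ?_
    filter_upwards [h.isOpen.mem_nhds hx] with y hy
    rw [real_inner_self_eq_norm_sq, h.unit y hy, one_pow]
  have := congrArg (fun l : E2 →L[ℝ] ℝ => l w) (h1.unique h2)
  simp [real_inner_comm] at this
  linarith

/-- Differentiating `⟨m, dF a⟩ = 0` along `b` expresses each side by the second derivative of `F`,
which is symmetric. -/
theorem symm (h : MinimalChart O F m K) {x : E2} (hx : x ∈ O) (a b : E2) :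
    inner ℝ (fderiv ℝ F x a) (fderiv ℝ m x b) = inner ℝ (fderiv ℝ F x b) (fderiv ℝ m x a) := by
  have hd := (h.normal_differentiableAt hx).hasFDerivAt
  have hF1 : ∀ᶠ y in nhds x, HasFDerivAt F (fderiv ℝ F y) y := by
    filter_upwards [h.isOpen.mem_nhds hx] with y hy
    exact ((h.contDiffAt hy).differentiableAt (by simp)).hasFDerivAt
  have hF2 : HasFDerivAt (fderiv ℝ F) (fderiv ℝ (fderiv ℝ F) x) x :=
    (differentiableAt_fderiv (h.contDiffAt hx)).hasFDerivAt
  have hs := second_derivative_symmetric_of_eventually hF1 hF2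
  have key : ∀ a b, inner ℝ (m x) (fderiv ℝ (fderiv ℝ F) x b a) +
      inner ℝ (fderiv ℝ m x b) (fderiv ℝ F x a) = 0 := by
    intro a b
    have h1 := hd.inner ℝ (hF2.clm_apply (hasFDerivAt_const a x))
    have h2 : HasFDerivAt (fun y => inner ℝ (m y) (fderiv ℝ F y a)) (0 : E2 →L[ℝ] ℝ) x := by
      refine (hasFDerivAt_const (0 : ℝ) x).congr_of_eventuallyEq ?_
      filter_upwards [h.isOpen.mem_nhds hx] with y hy using h.orth y hy a
    have := congrArg (fun l : E2 →L[ℝ] ℝ => l b) (h1.unique h2)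
    simpa using this
  have k1 := key a b
  have k2 := key b a
  rw [hs b a] at k1
  rw [real_inner_comm, real_inner_comm (fderiv ℝ m x a)]
  linarith

/-- The phase function: the coefficient that expresses a minimal surface by Scherk's form. -/
theorem exists_phase (h : MinimalChart O F m K) {x₀ : E2} (hx₀ : x₀ ∈ O) :
    ∃ H : E2 → ℂ, ∀ᶠ x in nhds x₀, DifferentiableAt ℝ H x ∧
      ‖H x‖ ^ 2 * (-K x) = 16 * ((1 - m x 0 ^ 2) * (1 - m x 1 ^ 2)) ∧
      ((1 - m x 0 ^ 2) * (1 - m x 1 ^ 2) ≠ 0 →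
        ∀ w, HasPhase (H x) (m x) (fderiv ℝ m x w) (fderiv ℝ F x w)) := by
  obtain ⟨u₀, v₀, hl₀⟩ := exists_isLift (h.unit x₀ hx₀)
  set u : E2 → ℂ := fun x => projFst u₀ v₀ (m x) with hu
  set v : E2 → ℂ := fun x => projSnd u₀ v₀ (m x) with hv
  -- The factor `4 / D²` comes from `IsLift.recover`, the quotient is the `g` of
  -- `IsLift.exists_weierstrass`, and `u⁴ - v⁴` cancels the denominator of the form. The expression
  -- stays differentiable where `u⁴ = v⁴`, which is what later excludes such points.
  refine ⟨fun x => 4 * (conj (isoDot (u x) (v x) (fderiv ℝ F x (planeVec 0))) /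
    isoDot (u x) (v x) (fderiv ℝ m x (planeVec 0))) * (u x ^ 4 - v x ^ 4) /
    (u x * conj (u x) + v x * conj (v x)) ^ 2, ?_⟩
  have e1 : ∀ᶠ x in nhds x₀, inner ℝ (m x₀) (m x) ≠ -1 := by
    have : ContinuousAt (fun x => inner ℝ (m x₀) (m x)) x₀ :=
      continuousAt_const.inner (h.normal_contDiffAt hx₀).continuousAt
    apply this.eventually_ne
    rw [real_inner_self_eq_norm_sq, h.unit x₀ hx₀]; norm_num
  filter_upwards [e1, h.isOpen.mem_nhds hx₀] with x hx1 hx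
  have hl : IsLift (u x) (v x) (m x) := hl₀.proj (h.unit x hx) hx1
  have hne : fderiv ℝ m x (planeVec 0) ≠ 0 := by
    intro h0
    have := h.normal_inj x hx (h0.trans (map_zero _).symm)
    have := congrArg (fun w : E2 => w 0) this
    simp [planeVec] at this
  have hq := hl.isoDot_ne_zero (h.normal_orth hx _) hne
  obtain ⟨a, b, c, hs, ht, hK⟩ := h.weingarten x hx
  obtain ⟨g, hg, gs, gt, gn⟩ := hl.exists_weierstrass (h.orth x hx _) (h.orth x hx _) hs ht
    (h.symm hx _ _) hne
  have hp := hl.pos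
  refine ⟨?_, ?_, fun hr w => ⟨u x, v x, hl, fun k => ?_⟩⟩
  · have du : DifferentiableAt ℝ u x :=
      (contDiffAt_projFst (h.normal_contDiffAt hx) u₀ v₀).differentiableAt (by simp)
    have dv : DifferentiableAt ℝ v x :=
      (contDiffAt_projSnd (h.normal_contDiffAt hx) u₀ v₀).differentiableAt (by simp)
    have dF : DifferentiableAt ℝ (fun y => fderiv ℝ F y (planeVec 0)) x :=
      (differentiableAt_fderiv (h.contDiffAt hx)).clm_apply
        (differentiableAt_const _)
    have dm : DifferentiableAt ℝ (fun y => fderiv ℝ m y (planeVec 0)) x :=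
      (differentiableAt_fderiv (h.normal_contDiffAt hx)).clm_apply (differentiableAt_const _)
    have dD : DifferentiableAt ℝ (fun y => (u y * conj (u y) + v y * conj (v y)) ^ 2) x :=
      ((du.mul (differentiableAt_conj du)).add (dv.mul (differentiableAt_conj dv))).pow 2
    have d1 := differentiableAt_conj (differentiableAt_isoDot du dv dF)
    have d2 := differentiableAt_isoDot du dv dm
    have hD := pow_ne_zero 2 hl.ne
    have hdiv : ∀ p r : E2 → ℂ, DifferentiableAt ℝ p x → DifferentiableAt ℝ r x → r x ≠ 0 →
        DifferentiableAt ℝ (fun y => p y / r y) x := fun p r hp hr h0 => by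
      simp only [div_eq_mul_inv]
      exact hp.fun_mul (hr.fun_inv h0)
    have dg := hdiv _ _ d1 d2 hq
    have dn := (dg.const_mul 4).fun_mul ((du.pow 4).fun_sub (dv.pow 4))
    exact hdiv _ _ dn dD hD
  · rw [← hg, ← sq_norm_eq_mul_conj, norm_div, norm_mul, norm_mul, norm_pow, Complex.norm_real,
      div_pow, mul_pow, mul_pow, hl.pow_four_normSq, hK, Real.norm_of_nonneg hp.le]
    simp only [neg_neg, Complex.norm_ofNat]
    field_simp
    linear_combination 16 * (1 - m x 0 ^ 2) * (1 - m x 1 ^ 2) * gn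
  · have h4 := sub_ne_zero.2 (hl.pow_four_ne_iff.2 hr)
    have hw : conj (isoDot (u x) (v x) (fderiv ℝ F x w)) =
        g * isoDot (u x) (v x) (fderiv ℝ m x w) := by
      rw [eq_planeVec w]
      simp only [map_add, map_smul, isoDot_add, isoDot_smul, map_mul, gs, gt, Complex.conj_ofReal]
      ring
    rw [hl.recover (h.orth x hx w) k, hw, ← hg, ← sq_norm_eq_mul_conj]
    have hp' : ((‖u x‖ ^ 2 + ‖v x‖ ^ 2 : ℝ) : ℂ) ≠ 0 := by exact_mod_cast hp.ne'
    congr 1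
    push_cast at hp' ⊢
    field_simp

/-- A phase function of constant modulus has derivative zero. -/
theorem fderiv_phase_eq_zero (h : MinimalChart O F m K) {x : E2} (hx : x ∈ O) {H : E2 → ℂ} {r : ℝ}
    (hr : r ≠ 0) (hreg : (1 - m x 0 ^ 2) * (1 - m x 1 ^ 2) ≠ 0)
    (hH : ∀ᶠ y in nhds x, DifferentiableAt ℝ H y ∧ ‖H y‖ ^ 2 = r ∧
      ∀ w, HasPhase (H y) (m y) (fderiv ℝ m y w) (fderiv ℝ F y w)) : fderiv ℝ H x = 0 := by
  obtain ⟨u₀, v₀, hl₀⟩ := exists_isLift (h.unit x hx)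
  set u : E2 → ℂ := fun x => projFst u₀ v₀ (m x) with hu
  set v : E2 → ℂ := fun x => projSnd u₀ v₀ (m x) with hv
  have cu : ContDiffAt ℝ 2 u x :=
    (contDiffAt_projFst (h.normal_contDiffAt hx) u₀ v₀).of_le two_le_infty
  have cv : ContDiffAt ℝ 2 v x :=
    (contDiffAt_projSnd (h.normal_contDiffAt hx) u₀ v₀).of_le two_le_infty
  have e1 : ∀ᶠ y in nhds x, inner ℝ (m x) (m y) ≠ -1 := by
    have : ContinuousAt (fun y => inner ℝ (m x) (m y)) x :=
      continuousAt_const.inner (h.normal_contDiffAt hx).continuousAt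
    apply this.eventually_ne
    rw [real_inner_self_eq_norm_sq, h.unit x hx]; norm_num
  have el : ∀ᶠ y in nhds x, y ∈ O ∧ IsLift (u y) (v y) (m y) := by
    filter_upwards [e1, h.isOpen.mem_nhds hx] with y hy1 hy
      using ⟨hy, hl₀.proj (h.unit y hy) hy1⟩
  have hl := el.self_of_nhds.2
  have h4 := hl.pow_four_ne_iff.2 hreg
  choose l hl2 hld using exists_scherk_potential cu cv h4
  have hd : ∀ᶠ y in nhds x, ∀ a, isoDot (u y) (v y) (fderiv ℝ m y a) =
      v y * fderiv ℝ u y a - u y * fderiv ℝ v y a := by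
    filter_upwards [el, el.eventually_nhds, cu.eventually (by simp), cv.eventually (by simp)]
      with y ⟨hy, _⟩ h1 h2 h3 a
    exact isoDot_fderiv (h2.differentiableAt (by simp)) (h3.differentiableAt (by simp))
      (h.normal_differentiableAt hy) (h1.mono fun _ hz => hz.2) a
  have hld' : ∀ k, ∀ᶠ y in nhds x, ∀ a, fderiv ℝ (l k) y a = isoVec (u y) (v y) k *
      (isoDot (u y) (v y) (fderiv ℝ m y a) / (u y ^ 4 - v y ^ 4)) := by
    intro k
    filter_upwards [hld k, hd] with y h1 h2 a
    rw [h1, h2]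
  have hY : ∀ k, ∀ᶠ y in nhds x, HasFDerivAt (fun y => F y k)
      (Complex.reCLM.comp (H y • fderiv ℝ (l k) y)) y := by
    intro k
    filter_upwards [hld' k, hH, el] with y h1 ⟨_, _, h2⟩ ⟨hy, hly⟩
    have hF := ((h.contDiffAt hy).differentiableAt (by simp)).hasFDerivAt
    refine ((EuclideanSpace.proj k : E3 →L[ℝ] ℝ).hasFDerivAt.comp y hF).congr_fderiv ?_
    ext w
    simp only [ContinuousLinearMap.comp_apply, EuclideanSpace.proj, PiLp.proj_apply,
      smul_apply, smul_eq_mul, Complex.reCLM_apply, h1 w]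
    exact (h2 w).eq_of_isLift hly k
  obtain ⟨hHd, hHn, -⟩ := hH.self_of_nhds
  have hH0 : H x ≠ 0 := fun h0 => hr (by rw [← hHn, h0]; simp)
  -- Closedness of the coordinate differentials of `F`. Next, `|H|` constant makes `dH / H` purely
  -- imaginary, with imaginary part `μ`.
  have hw := fun k => re_wedge_eq_zero hHd.hasFDerivAt (hl2 k) (hY k)
  have hre : ∀ a, (conj (H x) * fderiv ℝ H x a).re = 0 := by
    intro a
    have d1 := (hHd.hasFDerivAt.norm_sq).unique ((hasFDerivAt_const r x).congr_of_eventuallyEq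
      (hH.mono fun y hy => hy.2.1))
    have := congrArg (fun l : E2 →L[ℝ] ℝ => l a) d1
    simp [Complex.inner] at this ⊢
    linarith
  set μ : E2 → ℝ := fun a => (fderiv ℝ H x a / H x).im with hμ
  have hμe : ∀ a, fderiv ℝ H x a = Complex.I * μ a * H x := by
    intro a
    have h1 : (fderiv ℝ H x a / H x).re = 0 := by
      have e : fderiv ℝ H x a / H x =
          ((Complex.normSq (H x))⁻¹ : ℝ) * (conj (H x) * fderiv ℝ H x a) := by
        rw [div_eq_mul_inv, Complex.inv_def]; push_cast; ring
      rw [e, Complex.re_ofReal_mul, hre, mul_zero]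
    have h2 : fderiv ℝ H x a / H x = Complex.I * μ a := by
      apply Complex.ext <;> simp [h1, hμ]
    rw [← h2, div_mul_cancel₀ _ hH0]
  set q : E2 → ℂ := fun a => isoDot (u x) (v x) (fderiv ℝ m x a) with hq
  have hq0 : ∀ a, q a = 0 → a = 0 := by
    intro a ha
    by_contra ha0
    refine hl.isoDot_ne_zero (h.normal_orth hx a) (fun h0 => ha0 ?_) ha
    exact h.normal_inj x hx (h0.trans (map_zero _).symm)
  -- All components of a multiple of the isotropic vector have real part zero, so the multiplier
  -- vanishes: this is `μ ∧ q = 0`.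
  have key : ∀ a b, (μ a : ℂ) * q b = μ b * q a := by
    intro a b
    have : Complex.I * H x * (μ a * q b - μ b * q a) / (u x ^ 4 - v x ^ 4) = 0 := by
      apply eq_zero_of_re_mul_isoVec hl.ne_zero
      intro k
      have e := hw k a b
      rw [(hld' k).self_of_nhds, (hld' k).self_of_nhds, hμe, hμe, ← sub_eq_zero,
        ← Complex.sub_re] at e
      rw [← e]; congr 1; ring
    rw [div_eq_zero_iff, or_iff_left (sub_ne_zero.2 h4), mul_eq_zero,
      or_iff_right (mul_ne_zero Complex.I_ne_zero hH0)] at this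
    exact sub_eq_zero.1 this
  have hμ0 : ∀ a, μ a = 0 := by
    intro a
    by_contra ha
    -- As `μ` is real and `q` is real-linear and injective, the relation descends to vectors of the
    -- plane; `μ a ≠ 0` would make every `b` a multiple of `a`, which dimension two forbids.
    have hb : ∀ b, μ a • b - μ b • a = 0 := by
      intro b
      apply hq0
      rw [sub_eq_add_neg, ← neg_smul]
      simp only [hq, map_add, map_smul, isoDot_add, isoDot_smul]
      push_cast
      linear_combination key a b
    have b0 := congrArg (fun w : E2 => w 0) (hb (planeVec 0))
    have b1 := congrArg (fun w : E2 => w 1) (hb (planeVec 0))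
    have b2 := congrArg (fun w : E2 => w 0) (hb (planeVec 1))
    have b3 := congrArg (fun w : E2 => w 1) (hb (planeVec 1))
    simp [planeVec] at b0 b1 b2 b3
    rcases b1 with b1 | b1
    · simp [b1] at b0; exact ha b0
    · simp [b1] at b3; exact ha b3
  ext a
  rw [hμe, hμ0]; simp

/-- A chart where `(1 - m₀²) (1 - m₁²)` is a constant multiple of the curvature at the regular
points has no singular points, and its phase function is locally constant. -/
theorem exists_const_phase (h : MinimalChart O F m K) {C : ℝ} (hC : 0 < C)
    (hreg : ∀ x ∈ O, (1 - m x 0 ^ 2) * (1 - m x 1 ^ 2) ≠ 0 →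
      (1 - m x 0 ^ 2) * (1 - m x 1 ^ 2) = C * (-K x))
    (hiso : ∀ x ∈ O, ∀ᶠ y in nhdsWithin x {x}ᶜ, (1 - m y 0 ^ 2) * (1 - m y 1 ^ 2) ≠ 0)
    {x₀ : E2} (hx₀ : x₀ ∈ O) :
    ∃ c : ℂ, c ≠ 0 ∧ ∀ᶠ x in nhds x₀, (1 - m x 0 ^ 2) * (1 - m x 1 ^ 2) ≠ 0 ∧
      ∀ w, HasPhase c (m x) (fderiv ℝ m x w) (fderiv ℝ F x w) := by
  obtain ⟨H, hH⟩ := h.exists_phase hx₀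
  have hn : ∀ x ∈ O, ‖H x‖ ^ 2 * (-K x) = 16 * ((1 - m x 0 ^ 2) * (1 - m x 1 ^ 2)) →
      (1 - m x 0 ^ 2) * (1 - m x 1 ^ 2) ≠ 0 → ‖H x‖ ^ 2 = 16 * C := by
    intro x hx h1 h2
    have hK := h.neg x hx
    rw [hreg x hx h2, ← mul_assoc] at h1
    exact mul_right_cancel₀ (by linarith) h1
  have hcont : ContinuousAt (fun x => ‖H x‖ ^ 2) x₀ := by
    have := hH.self_of_nhds.1.continuousAt
    exact this.norm.pow 2
  -- The modulus is known at regular points only; these fill a punctured neighbourhood, and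
  -- continuity carries the value to `x₀`.
  have hn0 : ‖H x₀‖ ^ 2 = 16 * C := by
    refine tendsto_nhds_unique (hcont.tendsto.mono_left nhdsWithin_le_nhds)
      ((tendsto_const_nhds (f := nhdsWithin x₀ {x₀}ᶜ)).congr' ?_)
    filter_upwards [hiso x₀ hx₀, nhdsWithin_le_nhds hH,
      nhdsWithin_le_nhds (h.isOpen.mem_nhds hx₀)] with x h1 h2 h3
    exact (hn x h3 h2.2.1 h1).symm
  -- At a singular point the modulus identity would give `16 C (-K) = 0`.
  have hr0 : (1 - m x₀ 0 ^ 2) * (1 - m x₀ 1 ^ 2) ≠ 0 := by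
    intro h0
    have := hH.self_of_nhds.2.1
    rw [h0, hn0, mul_zero] at this
    have hK := h.neg x₀ hx₀
    nlinarith [mul_pos hC (neg_pos.2 hK)]
  have hall : ∀ᶠ x in nhds x₀, (x ∈ O ∧ (1 - m x 0 ^ 2) * (1 - m x 1 ^ 2) ≠ 0) ∧
      DifferentiableAt ℝ H x ∧ ‖H x‖ ^ 2 = 16 * C ∧
      ∀ w, HasPhase (H x) (m x) (fderiv ℝ m x w) (fderiv ℝ F x w) := by
    have h1 : ∀ᶠ x in nhds x₀, (1 - m x 0 ^ 2) * (1 - m x 1 ^ 2) ≠ 0 := by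
      filter_upwards [eventually_nhdsWithin_iff.1 (hiso x₀ hx₀)] with x hx
      by_cases hxx : x = x₀
      · rw [hxx]; exact hr0
      · exact hx hxx
    filter_upwards [hH, h1, h.isOpen.mem_nhds hx₀] with x ⟨a, b, c⟩ h2 h3
      using ⟨⟨h3, h2⟩, a, hn x h3 b h2, c h2⟩
  obtain ⟨ε, hε, hball⟩ := Metric.eventually_nhds_iff_ball.1 hall
  have hzero : Set.EqOn (fderiv ℝ H) 0 (Metric.ball x₀ ε) := by
    intro x hx
    refine h.fderiv_phase_eq_zero (hball x hx).1.1 (r := 16 * C) (by positivity)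
      (hball x hx).1.2 ?_
    filter_upwards [Metric.isOpen_ball.mem_nhds hx] with y hy using (hball y hy).2
  have hconst : ∀ x ∈ Metric.ball x₀ ε, H x = H x₀ := fun x hx =>
    Metric.isOpen_ball.is_const_of_fderiv_eq_zero (convex_ball x₀ ε).isPreconnected
      (fun y hy => (hball y hy).2.1.differentiableWithinAt) hzero hx (Metric.mem_ball_self hε)
  refine ⟨H x₀, fun h0 => ?_, ?_⟩
  · rw [h0] at hn0; simp at hn0; linarith
  · filter_upwards [Metric.ball_mem_nhds x₀ hε] with x hx
    refine ⟨(hball x hx).1.2, fun w => ?_⟩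
    rw [← hconst x hx]
    exact (hball x hx).2.2.2 w

end MinimalChart

/-! ### Passage from the manifold to charts -/

theorem trace_plane (T : E2 →ₗ[ℝ] E2) :
    LinearMap.trace ℝ E2 T = T (planeVec 0) 0 + T (planeVec 1) 1 := by
  rw [LinearMap.trace_eq_matrix_trace ℝ (EuclideanSpace.basisFun (Fin 2) ℝ).toBasis,
    Matrix.trace_fin_two]
  simp [LinearMap.toMatrix_apply, planeVec]

theorem det_plane (T : E2 →ₗ[ℝ] E2) :
    LinearMap.det T = T (planeVec 0) 0 * T (planeVec 1) 1 -
      T (planeVec 1) 0 * T (planeVec 0) 1 := by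
  rw [← LinearMap.det_toMatrix (EuclideanSpace.basisFun (Fin 2) ℝ).toBasis, Matrix.det_fin_two]
  simp [LinearMap.toMatrix_apply, planeVec]

section Chart

variable {M : Type*} [TopologicalSpace M] [ChartedSpace E2 M]

theorem surfDeriv_comp (B : E3 ≃ₗᵢ[ℝ] E3) {f : M → E3} {p : M}
    (hf : MDifferentiableAt (𝓡 2) 𝓘(ℝ, E3) f p) (v : TangentSpace (𝓡 2) p) :
    surfDeriv (B ∘ f) p v = B (surfDeriv f p v) := by
  have hB : HasFDerivAt B (B.toContinuousLinearEquiv : E3 →L[ℝ] E3) (f p) :=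
    B.toContinuousLinearEquiv.hasFDerivAt
  have := (hasMFDerivAt_iff_hasFDerivAt.2 hB).comp p hf.hasMFDerivAt
  rw [surfDeriv, this.mfderiv]
  rfl

variable [IsManifold (𝓡 2) ∞ M]

/-- One isomorphism `e`, the derivative of the inverse chart, serves all maps `f`, so that position
and normal are compared in the same coordinates. -/
theorem exists_chart_fderiv (p₀ : M) {x : E2} (hx : x ∈ (chartAt E2 p₀).target) {p : M}
    (hp : p = (chartAt E2 p₀).symm x) :
    ∃ e : E2 ≃ₗ[ℝ] TangentSpace (𝓡 2) p, ∀ f : M → E3,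
      MDifferentiableAt (𝓡 2) 𝓘(ℝ, E3) f p →
      DifferentiableAt ℝ (f ∘ (chartAt E2 p₀).symm) x ∧
      ∀ w, fderiv ℝ (f ∘ (chartAt E2 p₀).symm) x w = surfDeriv f p (e w) := by
  subst hp
  have : IsManifold (𝓡 2) 1 M := IsManifold.of_le (n := ∞) (by exact_mod_cast le_top)
  have hd := (mdifferentiable_chart (I := 𝓡 2) p₀).symm
  let e : E2 ≃L[ℝ] TangentSpace (𝓡 2) ((chartAt E2 p₀).symm x) := hd.mfderiv (x := x) hx
  refine ⟨e.toLinearEquiv, fun f hf => ?_⟩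
  have h1 := hf.hasMFDerivAt.comp x (hd.mdifferentiableAt (x := x) hx).hasMFDerivAt
  obtain ⟨L, hL, hLw⟩ : ∃ L : E2 →L[ℝ] E3, HasFDerivAt (f ∘ (chartAt E2 p₀).symm) L x ∧
      ∀ w, L w = surfDeriv f ((chartAt E2 p₀).symm x) (e w) :=
    ⟨_, hasMFDerivAt_iff_hasFDerivAt.1 h1, fun w => rfl⟩
  refine ⟨hL.differentiableAt, fun w => ?_⟩
  rw [hL.fderiv]
  exact hLw w

theorem contDiffOn_chart {f : M → E3} (hf : ContMDiff (𝓡 2) 𝓘(ℝ, E3) ∞ f) (p₀ : M) :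
    ContDiffOn ℝ ∞ (f ∘ (chartAt E2 p₀).symm) (chartAt E2 p₀).target :=
  contMDiffOn_iff_contDiffOn.1 (hf.comp_contMDiffOn (contMDiffOn_chart_symm (I := 𝓡 2)))

variable {X n : M → E3}

theorem surfDeriv_normal_orthogonal (hX : IsOrientedImmersion X n) (p : M)
    (v : TangentSpace (𝓡 2) p) : inner ℝ (n p) (surfDeriv n p v) = 0 := by
  have hp := mem_chart_source E2 p
  have hx := (chartAt E2 p).map_source hp
  have hpx := (chartAt E2 p).left_inv hp
  obtain ⟨e, he⟩ := exists_chart_fderiv p hx hpx.symm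
  obtain ⟨hd, hw⟩ := he n (hX.normal_smooth.mdifferentiableAt (by simp))
  have hd := hd.hasFDerivAt
  have h1 := hd.inner ℝ hd
  have h2 : HasFDerivAt (fun y => inner ℝ ((n ∘ (chartAt E2 p).symm) y)
      ((n ∘ (chartAt E2 p).symm) y)) (0 : E2 →L[ℝ] ℝ) (chartAt E2 p p) := by
    refine (hasFDerivAt_const (1 : ℝ) _).congr_of_eventuallyEq (Filter.Eventually.of_forall ?_)
    intro y
    simp only [Function.comp]
    rw [real_inner_self_eq_norm_sq, hX.normal_unit, one_pow]
  have := congrArg (fun l : E2 →L[ℝ] ℝ => l (e.symm v)) (h1.unique h2)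
  simp only [ContinuousLinearMap.comp_apply, ContinuousLinearMap.prod_apply, fderivInnerCLM_apply,
    hw, LinearEquiv.apply_symm_apply, Function.comp, hpx] at this
  rw [real_inner_comm (n p)] at this
  simpa using this

/-- By dimension the range of `dX` is the whole orthogonal complement of `n`, which contains the
range of `dn`; there the chosen left inverse is a true inverse. -/
theorem weingarten (hX : IsOrientedImmersion X n) (p : M) (v : TangentSpace (𝓡 2) p) :
    surfDeriv n p v = -surfDeriv X p (shapeOperator X n p v) := by
  have hrange : (surfDeriv X p).range = (ℝ ∙ n p)ᗮ := by
    apply Submodule.eq_of_le_of_finrank_eq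
    · rintro _ ⟨w, rfl⟩
      rw [Submodule.mem_orthogonal_singleton_iff_inner_right]
      exact hX.normal_orthogonal p w
    · have : Fact (Module.finrank ℝ E3 = 2 + 1) := ⟨by simp⟩
      rw [LinearMap.finrank_range_of_inj (hX.immersion p),
        Submodule.finrank_orthogonal_span_singleton (n := 2)]
      · exact finrank_euclideanSpace_fin
      · intro h0
        have := hX.normal_unit p
        rw [h0] at this; simp at this
  have hv : surfDeriv n p v ∈ (surfDeriv X p).range := by
    rw [hrange, Submodule.mem_orthogonal_singleton_iff_inner_right]
    exact surfDeriv_normal_orthogonal hX p v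
  obtain ⟨w, hw⟩ := hv
  have hli := LinearMap.congr_fun
    (LinearMap.leftInverse_comp_of_inj (LinearMap.ker_eq_bot.2 (hX.immersion p))) w
  simp only [LinearMap.comp_apply, LinearMap.id_apply] at hli
  simp only [shapeOperator, LinearMap.neg_apply, LinearMap.comp_apply, map_neg, neg_neg, ← hw, hli]

theorem surfDeriv_normal_injective (hX : IsOrientedImmersion X n) {p : M}
    (hK : gaussCurvature X n p < 0) : Function.Injective (surfDeriv n p) := by
  have hS : Function.Injective (shapeOperator X n p) := by
    have : FiniteDimensional ℝ (TangentSpace (𝓡 2) p) := inferInstanceAs (FiniteDimensional ℝ E2)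
    have : IsUnit (shapeOperator X n p) :=
      (LinearMap.isUnit_iff_isUnit_det _).2 (isUnit_iff_ne_zero.2 hK.ne)
    exact ((Module.End.isUnit_iff _).1 this).1
  intro v w h
  rw [weingarten hX, weingarten hX, neg_inj] at h
  exact hS (hX.immersion p h)

theorem exists_chart_frame (hX : IsOrientedImmersion X n) (B : E3 ≃ₗᵢ[ℝ] E3) (p₀ : M) {x : E2}
    (hx : x ∈ (chartAt E2 p₀).target) : ∃ p, p = (chartAt E2 p₀).symm x ∧
      ∃ e : E2 ≃ₗ[ℝ] TangentSpace (𝓡 2) p,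
      (∀ w, fderiv ℝ ((B ∘ X) ∘ (chartAt E2 p₀).symm) x w = B (surfDeriv X p (e w))) ∧
      (∀ w, fderiv ℝ ((B ∘ n) ∘ (chartAt E2 p₀).symm) x w = B (surfDeriv n p (e w))) := by
  have hB : ContMDiff 𝓘(ℝ, E3) 𝓘(ℝ, E3) ∞ B := B.contDiff.contMDiff
  have hBX := hB.comp hX.smooth
  have hBn := hB.comp hX.normal_smooth
  obtain ⟨e, he⟩ := exists_chart_fderiv p₀ hx rfl
  refine ⟨_, rfl, e, fun w => ?_, fun w => ?_⟩
  · rw [(he _ (hBX.mdifferentiableAt (by simp))).2,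
      surfDeriv_comp B (hX.smooth.mdifferentiableAt (by simp))]
  · rw [(he _ (hBn.mdifferentiableAt (by simp))).2,
      surfDeriv_comp B (hX.normal_smooth.mdifferentiableAt (by simp))]

theorem minimalChart (hX : IsMinimalSurface X n) (hK : ∀ p, gaussCurvature X n p < 0)
    (B : E3 ≃ₗᵢ[ℝ] E3) (p₀ : M) :
    MinimalChart (chartAt E2 p₀).target ((B ∘ X) ∘ (chartAt E2 p₀).symm)
      ((B ∘ n) ∘ (chartAt E2 p₀).symm) (fun x => gaussCurvature X n ((chartAt E2 p₀).symm x)) := by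
  have hO := hX.toIsOrientedImmersion
  have hB : ContMDiff 𝓘(ℝ, E3) 𝓘(ℝ, E3) ∞ B := B.contDiff.contMDiff
  have hBX := hB.comp hO.smooth
  have hBn := hB.comp hO.normal_smooth
  have hder := fun x hx => exists_chart_frame hO B p₀ (x := x) hx
  refine ⟨(chartAt E2 p₀).open_target, contDiffOn_chart hBX p₀, contDiffOn_chart hBn p₀, ?_, ?_,
    ?_, ?_, fun x _ => hK _⟩
  · intro x _
    simp only [Function.comp, LinearIsometryEquiv.norm_map, hO.normal_unit]
  · intro x hx w
    obtain ⟨p, hp, e, h1, -⟩ := hder x hx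
    rw [h1]
    simp only [Function.comp, LinearIsometryEquiv.inner_map_map, ← hp]
    exact hO.normal_orthogonal _ _
  · intro x hx v w h
    obtain ⟨p, hp, e, -, h2⟩ := hder x hx
    rw [h2, h2] at h
    exact e.injective (surfDeriv_normal_injective hO (hK _) (B.injective h))
  · intro x hx
    obtain ⟨p, hp, e, h1, h2⟩ := hder x hx
    simp only [← hp]
    -- The shape operator in chart coordinates; trace and determinant survive the conjugation and
    -- give the traceless matrix with determinant `K`.
    let T : E2 →ₗ[ℝ] E2 := (e.symm.conj (shapeOperator X n p))
    have hT : ∀ w, e (T w) = shapeOperator X n p (e w) := fun w => by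
      simp [T, LinearEquiv.conj_apply]
    have htr : T (planeVec 0) 0 + T (planeVec 1) 1 = 0 := by
      rw [← trace_plane, LinearMap.trace_conj']
      have := hX.minimal p
      rw [meanCurvature] at this
      linarith
    have hdet : gaussCurvature X n p = T (planeVec 0) 0 * T (planeVec 1) 1 -
        T (planeVec 1) 0 * T (planeVec 0) 1 := by
      rw [← det_plane, gaussCurvature]
      exact (LinearMap.det_conj (shapeOperator X n p) e.symm).symm
    have hN : ∀ w, fderiv ℝ ((B ∘ n) ∘ (chartAt E2 p₀).symm) x w =
        -fderiv ℝ ((B ∘ X) ∘ (chartAt E2 p₀).symm) x (T w) := by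
      intro w
      rw [h1, h2, weingarten hO, hT, map_neg]
    have h11 : T (planeVec 1) 1 = -T (planeVec 0) 0 := by linarith
    refine ⟨T (planeVec 0) 0, T (planeVec 1) 0, T (planeVec 0) 1, ?_, ?_, ?_⟩
    · rw [hN]
      conv_lhs => rw [eq_planeVec (T (planeVec 0))]
      rw [map_add, map_smul, map_smul]
    · rw [hN]
      conv_lhs => rw [eq_planeVec (T (planeVec 1)), h11]
      rw [map_add, map_smul, map_smul, neg_smul, sub_eq_add_neg]
    · rw [hdet, h11]; ring

end Chart

/-! ### Paths on the punctured sphere -/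

theorem IsLift.smul {u v : ℂ} {m : E3} (h : IsLift u v m) {c : ℂ} (hc : c ≠ 0) :
    IsLift (c * u) (c * v) m := by
  have hcc : c * conj c ≠ 0 := mul_ne_zero hc (by simpa using hc)
  refine ⟨?_, ?_, ?_⟩ <;> simp only [map_mul]
  · have := mul_ne_zero hcc h.ne
    contrapose! this
    linear_combination this
  · linear_combination c * conj c * h.xy
  · linear_combination c * conj c * h.z

/-- Every point of the sphere that is not a puncture is reached. -/
theorem exists_scherkReach (Θ : ℝ) {u v : ℂ} {m : E3} (h : IsLift u v m) (h4 : u ^ 4 ≠ v ^ 4) :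
    ∃ u' v' P, ScherkReach Θ u' v' P ∧ IsLift u' v' m := by
  have hfac : v - u ≠ 0 ∧ v + u ≠ 0 ∧ v - Complex.I * u ≠ 0 ∧ v + Complex.I * u ≠ 0 := by
    have h4 : v ^ 4 - u ^ 4 ≠ 0 := sub_ne_zero.2 h4.symm
    rw [scherk_factor] at h4
    simp only [mul_ne_zero_iff] at h4
    tauto
  obtain ⟨h1, h2, h3, h5⟩ := hfac
  -- The path is the segment from `(0, 1)` to `(c u, c v)` with `c = 1 + s i`. Each linear factor
  -- along it is `(1 - t) + t c w`, with `w` its value at `(u, v)`; it cannot vanish once `c w` is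
  -- not real, and this excludes at most one `s` per factor.
  obtain ⟨s, hs⟩ := Infinite.exists_notMem_finset
    ({-(v - u).im / (v - u).re, -(v + u).im / (v + u).re,
      -(v - Complex.I * u).im / (v - Complex.I * u).re,
      -(v + Complex.I * u).im / (v + Complex.I * u).re} : Finset ℝ)
  simp only [Finset.mem_insert, Finset.mem_singleton, not_or] at hs
  set c : ℂ := 1 + s * Complex.I with hc
  have hc0 : c ≠ 0 := fun h => by
    have := congrArg Complex.re h
    simp [hc] at this
  have him : ∀ w : ℂ, w ≠ 0 → s ≠ -w.im / w.re → (c * w).im ≠ 0 := by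
    intro w hw hsw h0
    have h0' : w.im + s * w.re = 0 := by
      rw [← h0, hc]; simp
    -- Here the excluded value is `0` by the division convention; it is not needed, since `Im (c w)
    -- = Im w ≠ 0`.
    by_cases hr : w.re = 0
    · rw [hr, mul_zero, add_zero] at h0'
      exact hw (Complex.ext hr h0')
    · apply hsw
      rw [eq_div_iff hr]; linarith
  have hne : ∀ w : ℂ, (c * w).im ≠ 0 → ∀ t : ℝ, (1 - t : ℂ) + t * (c * w) ≠ 0 := by
    intro w hw t h0
    have e1 := congrArg Complex.im h0
    have e2 := congrArg Complex.re h0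
    rw [Complex.add_im, Complex.im_ofReal_mul] at e1
    rw [Complex.add_re, Complex.re_ofReal_mul] at e2
    simp only [Complex.sub_im, Complex.one_im, Complex.ofReal_im, sub_zero, zero_add, mul_eq_zero,
      Complex.zero_im, or_iff_left hw] at e1
    rw [e1] at e2
    simp at e2
  have hcont : ContDiff ℝ 1 (fun t : ℝ => (t : ℂ)) := Complex.ofRealCLM.contDiff
  have := ScherkReach.step (Θ := Θ) (fun t : ℝ => (t : ℂ) * (c * u))
    (fun t : ℝ => (1 - t : ℂ) + t * (c * v)) (hcont.mul contDiff_const)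
    ((contDiff_const.sub hcont).add (hcont.mul contDiff_const)) (P := 0) ?_ ?_
  · simp only [Complex.ofReal_one, one_mul, sub_self, zero_add] at this
    exact ⟨_, _, _, this, h.smul hc0⟩
  · intro t _ h0
    have : ((1 - t : ℂ) + t * (c * v)) ^ 4 - ((t : ℂ) * (c * u)) ^ 4 = 0 := by rw [h0, sub_self]
    rw [scherk_factor] at this
    have w1 := hne _ (him _ h1 hs.1) t
    have w2 := hne _ (him _ h2 hs.2.1) t
    have w3 := hne _ (him _ h3 hs.2.2.1) t
    have w4 := hne _ (him _ h5 hs.2.2.2) t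
    refine mul_ne_zero (mul_ne_zero (mul_ne_zero w1 w2) w3) w4 ?_
    rw [← this]; ring
  · simpa using ScherkReach.base

/-- The Weierstrass integral along a curve on a surface with constant phase. -/
theorem ScherkReach.extend {Θ ρ : ℝ} {u₀ v₀ : ℂ} {P : E3} (hP : ScherkReach Θ u₀ v₀ P)
    {m Y : ℝ → E3} (hm : ContDiff ℝ 1 m) (hY : ContDiff ℝ 1 Y) (hl : IsLift u₀ v₀ (m 0))
    (hunit : ∀ t, ‖m t‖ = 1) (hne : ∀ t, inner ℝ (m 0) (m t) ≠ -1)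
    (hreg : ∀ t, (1 - m t 0 ^ 2) * (1 - m t 1 ^ 2) ≠ 0)
    (hph : ∀ t, HasPhase (ρ * Complex.exp (Θ * Complex.I)) (m t) (deriv m t) (deriv Y t)) :
    ∃ u v P', ScherkReach Θ u v P' ∧ IsLift u v (m 1) ∧ Y 1 = ρ • P' + (Y 0 - ρ • P) := by
  set u : ℝ → ℂ := fun t => projFst u₀ v₀ (m t) with hu
  set v : ℝ → ℂ := fun t => projSnd u₀ v₀ (m t) with hv
  have cu : ContDiff ℝ 1 u := contDiff_iff_contDiffAt.2 fun t =>
    contDiffAt_projFst hm.contDiffAt u₀ v₀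
  have cv : ContDiff ℝ 1 v := contDiff_iff_contDiffAt.2 fun t =>
    contDiffAt_projSnd hm.contDiffAt u₀ v₀
  have hlt : ∀ t, IsLift (u t) (v t) (m t) := fun t => hl.proj (hunit t) (hne t)
  have h4 : ∀ t, u t ^ 4 ≠ v t ^ 4 := fun t => (hlt t).pow_four_ne_iff.2 (hreg t)
  -- Consecutive steps must agree in homogeneous coordinates, not only in `z`; projecting the
  -- starting lift ensures this.
  have h0 : u 0 = u₀ ∧ v 0 = v₀ := hl.proj_self
  have hstep := ScherkReach.step (Θ := Θ) u v cu cv (fun t _ => h4 t) (P := P)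
    (by rw [h0.1, h0.2]; exact hP)
  refine ⟨_, _, _, hstep, hlt 1, ?_⟩
  have hdu : ∀ t, HasDerivAt u (deriv u t) t := fun t =>
    ((cu.differentiable one_ne_zero) t).hasDerivAt
  have hdv : ∀ t, HasDerivAt v (deriv v t) t := fun t =>
    ((cv.differentiable one_ne_zero) t).hasDerivAt
  have hdm : ∀ t, HasDerivAt m (deriv m t) t := fun t =>
    ((hm.differentiable one_ne_zero) t).hasDerivAt
  have hdY : ∀ t, HasDerivAt Y (deriv Y t) t := fun t =>
    ((hY.differentiable one_ne_zero) t).hasDerivAt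
  have hdot : ∀ t, isoDot (u t) (v t) (deriv m t) = v t * deriv u t - u t * deriv v t := fun t =>
    isoDot_deriv (hdu t) (hdv t) (hdm t) (Filter.Eventually.of_forall hlt)
  suffices hs : ∀ k, Y 1 k - Y 0 k = ρ * scherkIntegral Θ u v k by
    ext k
    have := hs k
    simp only [PiLp.add_apply, PiLp.smul_apply, PiLp.sub_apply, smul_eq_mul]
    linarith
  intro k
  have hYk : ∀ t, HasDerivAt (fun t => Y t k) (deriv Y t k) t := fun t =>
    (EuclideanSpace.proj k : E3 →L[ℝ] ℝ).hasFDerivAt.comp_hasDerivAt t (hdY t)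
  set f : ℝ → ℂ := fun t => Complex.exp (Θ * Complex.I) *
    scherkForm (u t) (v t) (deriv u t) (deriv v t) k with hf
  have hfY : ∀ t, deriv Y t k = ρ * (f t).re := by
    intro t
    rw [(hph t).eq_of_isLift (hlt t) k, hf, mul_assoc, Complex.re_ofReal_mul]
    simp only [scherkForm_eq, hdot]
  have hvec : Continuous fun t => isoVec (u t) (v t) k := by
    have c1 := cu.continuous
    have c2 := cv.continuous
    fin_cases k <;> simp [isoVec] <;> fun_prop
  have hfc : Continuous f := by
    have c1 := cu.continuous
    have c2 := cv.continuous
    have c3 := cu.continuous_deriv le_rfl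
    have c4 := cv.continuous_deriv le_rfl
    simp only [hf, scherkForm_eq]
    exact continuous_const.mul (hvec.mul (((c2.mul c3).sub (c1.mul c4)).div
      ((c1.pow 4).sub (c2.pow 4)) fun t => sub_ne_zero.2 (h4 t)))
  have hcY : Continuous fun t => deriv Y t k := by
    simp only [hfY]
    exact continuous_const.mul (Complex.continuous_re.comp hfc)
  rw [← intervalIntegral.integral_eq_sub_of_hasDerivAt (fun t _ => hYk t)
    (hcY.intervalIntegrable 0 1)]
  simp only [hfY, intervalIntegral.integral_const_mul]
  congr 1
  exact Complex.reCLM.intervalIntegral_comp_comm (hfc.intervalIntegrable 0 1)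

/-! ### Continuation over the connected surface -/

section Global

variable {M : Type*} [TopologicalSpace M] [ChartedSpace E2 M]

/-- In the frame `B`, the surface has the constant phase `h` and no singular points. -/
def HasConstPhase (X n : M → E3) (B : E3 ≃ₗᵢ[ℝ] E3) (h : ℂ) : Prop :=
  ∀ p, (1 - B (n p) 0 ^ 2) * (1 - B (n p) 1 ^ 2) ≠ 0 ∧
    ∀ w, HasPhase h (B (n p)) (B (surfDeriv n p w)) (B (surfDeriv X p w))

variable {X n : M → E3}

theorem HasConstPhase.trans_reflIso {B : E3 ≃ₗᵢ[ℝ] E3} {h : ℂ} (H : HasConstPhase X n B h) :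
    HasConstPhase X n (B.trans reflIso) (conj h) := by
  intro p
  obtain ⟨h1, h2⟩ := H p
  obtain ⟨a, b, -⟩ := reflIso_apply (B (n p))
  refine ⟨?_, fun w => (h2 w).reflIso⟩
  simp only [LinearIsometryEquiv.trans_apply, a, b, neg_sq]
  exact h1

theorem HasConstPhase.trans_swapIso {B : E3 ≃ₗᵢ[ℝ] E3} {h : ℂ} (H : HasConstPhase X n B h) :
    HasConstPhase X n (B.trans swapIso) (-conj h) := by
  intro p
  obtain ⟨h1, h2⟩ := H p
  obtain ⟨a, b, -⟩ := swapIso_apply (B (n p))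
  refine ⟨?_, fun w => (h2 w).swapIso⟩
  simp only [LinearIsometryEquiv.trans_apply, a, b]
  rwa [mul_comm]

/-- By a symmetry of the frame, the phase may be taken in the closed first quadrant. -/
theorem HasConstPhase.exists_quadrant {B : E3 ≃ₗᵢ[ℝ] E3} {h : ℂ} (H : HasConstPhase X n B h)
    (h0 : h ≠ 0) : ∃ B' h', HasConstPhase X n B' h' ∧ h' ≠ 0 ∧ 0 ≤ h'.re ∧ 0 ≤ h'.im := by
  obtain ⟨B', h', H', h0', hre⟩ : ∃ B' h', HasConstPhase X n B' h' ∧ h' ≠ 0 ∧ 0 ≤ h'.re := by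
    rcases le_total 0 h.re with hr | hr
    · exact ⟨B, h, H, h0, hr⟩
    · exact ⟨_, _, H.trans_swapIso, by simpa using h0, by simpa using hr⟩
  rcases le_total 0 h'.im with hi | hi
  · exact ⟨B', h', H', h0', hre, hi⟩
  · exact ⟨_, _, H'.trans_reflIso, by simpa using h0', by simpa using hre, by simpa using hi⟩

variable [IsManifold (𝓡 2) ∞ M]

/-- Continuation of a value of the Weierstrass integral inside a small chart ball. -/
theorem exists_nhds_extend (hX : IsOrientedImmersion X n) {B : E3 ≃ₗᵢ[ℝ] E3} {Θ ρ : ℝ}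
    (H : HasConstPhase X n B (ρ * Complex.exp (Θ * Complex.I))) (b : E3) (p₀ : M) :
    ∃ U ∈ nhds p₀, ∀ x ∈ U, ∀ y ∈ U,
      (∃ u v P, ScherkReach Θ u v P ∧ IsLift u v (B (n x)) ∧ B (X x) = ρ • P + b) →
      (∃ u v P, ScherkReach Θ u v P ∧ IsLift u v (B (n y)) ∧ B (X y) = ρ • P + b) := by
  set φ := chartAt E2 p₀ with hφ
  have hB : ContMDiff 𝓘(ℝ, E3) 𝓘(ℝ, E3) ∞ B := B.contDiff.contMDiff
  have cX := contDiffOn_chart (hB.comp hX.smooth) p₀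
  have cn := contDiffOn_chart (hB.comp hX.normal_smooth) p₀
  rw [← hφ] at cX cn
  have hp₀ : p₀ ∈ φ.source := mem_chart_source E2 p₀
  have hx₀ : φ p₀ ∈ φ.target := φ.map_source hp₀
  -- Normals within distance `1` of a common one are less than `2` apart, hence never antipodal, so
  -- the projected lift exists along the whole curve.
  have hev : ∀ᶠ x in nhds (φ p₀), x ∈ φ.target ∧
      dist (((B ∘ n) ∘ φ.symm) x) (((B ∘ n) ∘ φ.symm) (φ p₀)) < 1 := by
    refine Filter.Eventually.and (φ.open_target.mem_nhds hx₀) ?_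
    exact (cn.contDiffAt (φ.open_target.mem_nhds hx₀)).continuousAt.eventually
      (Metric.ball_mem_nhds _ one_pos)
  obtain ⟨ε, hε, hball⟩ := Metric.eventually_nhds_iff_ball.1 hev
  refine ⟨φ.source ∩ φ ⁻¹' Metric.ball (φ p₀) ε,
    φ.isOpen_inter_preimage Metric.isOpen_ball |>.mem_nhds ⟨hp₀, Metric.mem_ball_self hε⟩, ?_⟩
  rintro x ⟨hxs, hxb⟩ y ⟨hys, hyb⟩ ⟨u, v, P, hP, hl, hPX⟩
  -- The smooth transition has values in `[0, 1]`, so the curve is smooth and stays in the ball for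
  -- every real `t`.
  set γ : ℝ → E2 := fun t => φ x + Real.smoothTransition t • (φ y - φ x) with hγ
  have hγb : ∀ t, γ t ∈ Metric.ball (φ p₀) ε := fun t =>
    (convex_ball (φ p₀) ε).add_smul_sub_mem hxb hyb
      ⟨Real.smoothTransition.nonneg t, Real.smoothTransition.le_one t⟩
  have hγc : ContDiff ℝ ∞ γ :=
    contDiff_const.add (Real.smoothTransition.contDiff.smul contDiff_const)
  have hγ0 : φ.symm (γ 0) = x := by simp [hγ, φ.left_inv hxs]
  have hγ1 : φ.symm (γ 1) = y := by simp [hγ, φ.left_inv hys]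
  have hγt : ∀ t, γ t ∈ φ.target := fun t => (hball _ (hγb t)).1
  have hcomp : ∀ {f : E2 → E3}, ContDiffOn ℝ ∞ f φ.target → ContDiff ℝ 1 (f ∘ γ) ∧
      ∀ t, deriv (f ∘ γ) t = fderiv ℝ f (γ t) (deriv γ t) := by
    intro f hf
    refine ⟨(hf.comp_contDiff hγc hγt).of_le (by exact_mod_cast le_top), fun t => ?_⟩
    have h1 := ((hf.contDiffAt (φ.open_target.mem_nhds (hγt t))).differentiableAt
      (by simp)).hasFDerivAt
    exact (h1.comp_hasDerivAt t ((hγc.differentiable (by simp)) t).hasDerivAt).deriv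
  obtain ⟨cm, dm⟩ := hcomp cn
  obtain ⟨cY, dY⟩ := hcomp cX
  have hunit : ∀ t, ‖(((B ∘ n) ∘ φ.symm) ∘ γ) t‖ = 1 := fun t => by
    simp only [Function.comp, LinearIsometryEquiv.norm_map, hX.normal_unit]
  have hne : ∀ t, inner ℝ ((((B ∘ n) ∘ φ.symm) ∘ γ) 0) ((((B ∘ n) ∘ φ.symm) ∘ γ) t) ≠ -1 := by
    intro t ht
    have h1 := (hball _ (hγb 0)).2
    have h2 := (hball _ (hγb t)).2
    have h3 := dist_triangle_right ((((B ∘ n) ∘ φ.symm) ∘ γ) 0) ((((B ∘ n) ∘ φ.symm) ∘ γ) t)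
      (((B ∘ n) ∘ φ.symm) (φ p₀))
    have h4 : dist ((((B ∘ n) ∘ φ.symm) ∘ γ) 0) ((((B ∘ n) ∘ φ.symm) ∘ γ) t) < 2 := by
      simp only [Function.comp] at h1 h2 h3 ⊢
      linarith
    rw [dist_eq_norm] at h4
    have h5 := norm_sub_sq_real ((((B ∘ n) ∘ φ.symm) ∘ γ) 0) ((((B ∘ n) ∘ φ.symm) ∘ γ) t)
    rw [ht, hunit, hunit] at h5
    nlinarith [norm_nonneg ((((B ∘ n) ∘ φ.symm) ∘ γ) 0 - (((B ∘ n) ∘ φ.symm) ∘ γ) t)]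
  have hph : ∀ t, HasPhase (ρ * Complex.exp (Θ * Complex.I)) ((((B ∘ n) ∘ φ.symm) ∘ γ) t)
      (deriv (((B ∘ n) ∘ φ.symm) ∘ γ) t) (deriv (((B ∘ X) ∘ φ.symm) ∘ γ) t) := by
    intro t
    obtain ⟨p, hp, e, h1, h2⟩ := exists_chart_frame hX B p₀ (hγt t)
    rw [dm, dY]
    have := (H p).2 (e (deriv γ t))
    rw [← h1, ← h2] at this
    rw [hp] at this
    exact this
  obtain ⟨u', v', P', hP', hl', hY'⟩ := hP.extend (ρ := ρ) cm cY
    (by simpa only [Function.comp, hγ0] using hl) hunit hne (fun t => (H _).1) hph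
  refine ⟨u', v', P', hP', by simpa only [Function.comp, hγ1] using hl', ?_⟩
  simp only [Function.comp, hγ0, hγ1] at hY'
  rw [hY', hPX]
  abel_nf

/-- A surface of constant phase is similar to a part of a member of Scherk's family. -/
theorem HasConstPhase.isSimilarToPartOf [ConnectedSpace M] (hX : IsOrientedImmersion X n)
    {B : E3 ≃ₗᵢ[ℝ] E3} {h : ℂ} (H : HasConstPhase X n B h) (h0 : h ≠ 0) (hre : 0 ≤ h.re)
    (him : 0 ≤ h.im) :
    ∃ Θ ∈ Set.Icc (0 : ℝ) (Real.pi / 2), IsSimilarToPartOf X n (scherkMember Θ) := by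
  refine ⟨h.arg, ⟨Complex.arg_nonneg_iff.2 him,
    (le_abs_self _).trans (Complex.abs_arg_le_pi_div_two_iff.2 hre)⟩, ‖h‖, norm_pos_iff.2 h0, ?_⟩
  rw [← Complex.norm_mul_exp_arg_mul_I h] at H
  obtain ⟨p₁⟩ : Nonempty M := inferInstance
  have hu : ∀ p, ‖B (n p)‖ = 1 := fun p => by rw [LinearIsometryEquiv.norm_map, hX.normal_unit]
  obtain ⟨u₁, v₁, hl₁⟩ := exists_isLift (hu p₁)
  obtain ⟨u, v, P₁, hP₁, hl⟩ := exists_scherkReach h.arg hl₁ (hl₁.pow_four_ne_iff.2 (H p₁).1)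
  set b : E3 := B (X p₁) - ‖h‖ • P₁ with hb
  set G : Set M := {p | ∃ u v P, ScherkReach h.arg u v P ∧ IsLift u v (B (n p)) ∧
    B (X p) = ‖h‖ • P + b} with hG
  have hloc := fun p => exists_nhds_extend hX H b p
  -- The continuation lemma is symmetric in its two points: one direction shows that `G` is open,
  -- the other that its complement is.
  have hclopen : IsClopen G := by
    refine ⟨⟨isOpen_iff_mem_nhds.2 fun p hp => ?_⟩, isOpen_iff_mem_nhds.2 fun p hp => ?_⟩
    · obtain ⟨U, hU, hxy⟩ := hloc p
      filter_upwards [hU] with y hy hyG using hp (hxy y hy p (mem_of_mem_nhds hU) hyG)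
    · obtain ⟨U, hU, hxy⟩ := hloc p
      filter_upwards [hU] with y hy using hxy p (mem_of_mem_nhds hU) y hy hp
  have huniv := hclopen.eq_univ ⟨p₁, u, v, P₁, hP₁, hl, by rw [hb]; abel⟩
  refine ⟨B.symm.toAffineIsometryEquiv.trans (AffineIsometryEquiv.constVAdd ℝ E3 (B.symm b)),
    fun p => ?_⟩
  obtain ⟨u, v, P, hP, hl, hPX⟩ : p ∈ G := huniv ▸ Set.mem_univ p
  refine ⟨(P, sphereOf u v), ⟨u, v, hP, rfl⟩, ?_, ?_⟩
  · change X p = B.symm b + B.symm (‖h‖ • P)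
    rw [← map_add, add_comm, ← hPX, LinearIsometryEquiv.symm_apply_apply]
  · rw [hl.sphereOf_eq]
    change n p = B.symm (B (n p))
    rw [LinearIsometryEquiv.symm_apply_apply]

theorem exists_hasConstPhase [ConnectedSpace M] (hX : IsMinimalSurface X n)
    (hK : ∀ p, gaussCurvature X n p < 0) (B : E3 ≃ₗᵢ[ℝ] E3) {C : ℝ} (hC : 0 < C)
    (hreg : ∀ p, (1 - B (n p) 0 ^ 2) * (1 - B (n p) 1 ^ 2) ≠ 0 →
      (1 - B (n p) 0 ^ 2) * (1 - B (n p) 1 ^ 2) = C * (-gaussCurvature X n p))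
    (S : Finset E3) (hS : ∀ p, n p ∉ S → (1 - B (n p) 0 ^ 2) * (1 - B (n p) 1 ^ 2) ≠ 0) :
    ∃ h, h ≠ 0 ∧ HasConstPhase X n B h := by
  have hO := hX.toIsOrientedImmersion
  have hloc : ∀ p₀ : M, ∃ c : ℂ, c ≠ 0 ∧ ∀ᶠ p in nhds p₀,
      (1 - B (n p) 0 ^ 2) * (1 - B (n p) 1 ^ 2) ≠ 0 ∧
      ∀ w, HasPhase c (B (n p)) (B (surfDeriv n p w)) (B (surfDeriv X p w)) := by
    intro p₀
    have hch := minimalChart hX hK B p₀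
    have hp₀ := mem_chart_source E2 p₀
    have hx₀ := (chartAt E2 p₀).map_source hp₀
    have hiso : ∀ x ∈ (chartAt E2 p₀).target, ∀ᶠ y in nhdsWithin x {x}ᶜ,
        (1 - ((B ∘ n) ∘ (chartAt E2 p₀).symm) y 0 ^ 2) *
          (1 - ((B ∘ n) ∘ (chartAt E2 p₀).symm) y 1 ^ 2) ≠ 0 := by
      intro x hx
      have hd := (hch.normal_differentiableAt hx).hasFDerivAt
      obtain ⟨k, -, hk⟩ := (fderiv ℝ ((B ∘ n) ∘ (chartAt E2 p₀).symm) x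
        : E2 →ₗ[ℝ] E3).exists_antilipschitzWith (LinearMap.ker_eq_bot.2 (hch.normal_inj x hx))
      -- An injective derivative in finite dimension is bounded below, so near `x` the normal takes
      -- each of the finitely many values at most at `x` itself.
      have : ∀ᶠ y in nhdsWithin x {x}ᶜ, ∀ s ∈ S, ((B ∘ n) ∘ (chartAt E2 p₀).symm) y ≠ B s :=
        (Filter.eventually_all_finset S).2 fun s _ => hd.eventually_ne ⟨k, hk⟩
      filter_upwards [this] with y hy
      exact hS _ fun hm => hy _ hm rfl
    obtain ⟨c, hc, hev⟩ := hch.exists_const_phase hC (fun x _ => hreg _) hiso hx₀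
    refine ⟨c, hc, ?_⟩
    have hcont := (chartAt E2 p₀).continuousAt hp₀
    filter_upwards [hcont.eventually hev, hcont.eventually ((chartAt E2 p₀).open_target.mem_nhds
      hx₀), (chartAt E2 p₀).open_source.mem_nhds hp₀] with p h1 h2 h3
    obtain ⟨q, hq, e, e1, e2⟩ := exists_chart_frame hO B p₀ h2
    rw [(chartAt E2 p₀).left_inv h3] at hq
    subst hq
    simp only [Function.comp_apply, (chartAt E2 p₀).left_inv h3] at h1
    refine ⟨h1.1, fun w => ?_⟩
    have := h1.2 (e.symm w)
    rwa [e1, e2, e.apply_symm_apply] at this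
  choose c hc hcp using hloc
  -- The constants of neighbouring points agree because the phase is determined by one nonzero
  -- tangent vector at a regular point.
  have hlc : IsLocallyConstant c := by
    rw [IsLocallyConstant.iff_eventually_eq]
    intro p₀
    filter_upwards [hcp p₀] with p hp
    obtain ⟨h1, h2⟩ := (hcp p).self_of_nhds
    have hinj := surfDeriv_normal_injective hO (hK p)
    have hne : ∃ w : TangentSpace (𝓡 2) p, w ≠ 0 := by
      have : Nontrivial (TangentSpace (𝓡 2) p) := inferInstanceAs (Nontrivial E2)
      exact exists_ne 0
    obtain ⟨w, hw⟩ := hne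
    refine (h2 w).unique (hp.2 w) ?_ ?_ h1
    · rw [LinearIsometryEquiv.inner_map_map]; exact surfDeriv_normal_orthogonal hO p w
    · intro h0
      apply hw
      apply hinj
      rw [map_zero]
      exact B.injective (h0.trans (map_zero B).symm)
  obtain ⟨p₁⟩ : Nonempty M := inferInstance
  refine ⟨c p₁, hc p₁, fun p => ?_⟩
  rw [hlc.apply_eq_of_isPreconnected isPreconnected_univ (Set.mem_univ p₁) (Set.mem_univ p)]
  exact (hcp p).self_of_nhds

end Global

/-! ### Comparison of the two logarithmic functions -/

section Functions

variable {V₁ V₂ N : E3}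

theorem one_sub_inner_sq_pos (hV : ‖V₁‖ = 1) (hN : ‖N‖ = 1) (h1 : N ≠ V₁) (h2 : N ≠ -V₁) :
    0 < 1 - inner ℝ N V₁ ^ 2 := by
  have a : inner ℝ N V₁ < 1 := inner_lt_one_iff_real_of_norm_eq_one hN hV |>.2 h1
  have b : inner ℝ N (-V₁) < 1 :=
    inner_lt_one_iff_real_of_norm_eq_one hN (by rwa [norm_neg]) |>.2 h2
  rw [inner_neg_right] at b
  nlinarith

variable {M : Type*} [TopologicalSpace M] [ChartedSpace (EuclideanSpace ℝ (Fin 2)) M]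
  {X n : M → E3}

/-- Opposite directions pair up as `(1 - n_V) (1 + n_V) = 1 - n_V²`, and the four square roots
multiply to `K²`; the product is the square of the argument of `F'`. -/
theorem chernRicciSum_eq (hn : ∀ p, ‖n p‖ = 1) (hK : ∀ p, gaussCurvature X n p < 0)
    (hV₁ : ‖V₁‖ = 1) (hV₂ : ‖V₂‖ = 1) {p : M} (hp : p ∈ scherkRegular n V₁ V₂) :
    chernRicciSum X n V₁ V₂ p = 2 * scherkLog X n V₁ V₂ p := by
  obtain ⟨h1, h2, h3, h4⟩ := hp
  have a := one_sub_inner_sq_pos hV₁ (hn p) h1 h2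
  have b := one_sub_inner_sq_pos hV₂ (hn p) h3 h4
  have k : 0 < -gaussCurvature X n p := neg_pos.2 (hK p)
  have hs := Real.sqrt_pos.2 k
  have hss := Real.sq_sqrt k.le
  simp only [chernRicciSum, chernRicci, scherkLog, inner_neg_right, sub_neg_eq_add]
  have e1 : 1 - inner ℝ (n p) V₁ ^ 2 = (1 - inner ℝ (n p) V₁) * (1 + inner ℝ (n p) V₁) := by ring
  have e2 : 1 - inner ℝ (n p) V₂ ^ 2 = (1 - inner ℝ (n p) V₂) * (1 + inner ℝ (n p) V₂) := by ring
  rw [e1] at a ⊢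
  rw [e2] at b ⊢
  have a1 := left_ne_zero_of_mul a.ne'
  have a2 := right_ne_zero_of_mul a.ne'
  have b1 := left_ne_zero_of_mul b.ne'
  have b2 := right_ne_zero_of_mul b.ne'
  have hs0 := hs.ne'
  have hk : Real.log (-gaussCurvature X n p) = 2 * Real.log √(-gaussCurvature X n p) := by
    conv_lhs => rw [← hss]
    rw [Real.log_pow]; norm_num
  rw [Real.log_div (pow_ne_zero 2 a1) hs0, Real.log_div (pow_ne_zero 2 a2) hs0,
    Real.log_div (pow_ne_zero 2 b1) hs0, Real.log_div (pow_ne_zero 2 b2) hs0,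
    Real.log_div (mul_ne_zero a.ne' b.ne') k.ne', Real.log_mul a.ne' b.ne', Real.log_mul a1 a2,
    Real.log_mul b1 b2, hk]
  simp only [Real.log_pow]
  push_cast
  ring

end Functions

end

/-! ### The main theorem -/

theorem mainTheorem1 {M : Type*} [TopologicalSpace M]
    [ChartedSpace (EuclideanSpace ℝ (Fin 2)) M] [IsManifold (𝓡 2) ∞ M] [ConnectedSpace M]
    (X n : M → E3) (hX : IsMinimalSurface X n) (hK : ∀ p, gaussCurvature X n p < 0)
    (V₁ V₂ : E3) (hV₁ : ‖V₁‖ = 1) (hV₂ : ‖V₂‖ = 1) (hV : inner ℝ V₁ V₂ = 0) :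
    ((∃ c : ℝ, ∀ p ∈ scherkRegular n V₁ V₂, chernRicciSum X n V₁ V₂ p = c) ↔
      (∃ c : ℝ, ∀ p ∈ scherkRegular n V₁ V₂, scherkLog X n V₁ V₂ p = c)) ∧
    ((∃ c : ℝ, ∀ p ∈ scherkRegular n V₁ V₂, chernRicciSum X n V₁ V₂ p = c) →
      ∃ Θ ∈ Set.Icc (0 : ℝ) (Real.pi / 2), IsSimilarToPartOf X n (scherkMember Θ)) := by
  have hO := hX.toIsOrientedImmersion
  have hsum : ∀ p ∈ scherkRegular n V₁ V₂, chernRicciSum X n V₁ V₂ p = 2 * scherkLog X n V₁ V₂ p :=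
    fun p hp => chernRicciSum_eq hO.normal_unit hK hV₁ hV₂ hp
  refine ⟨⟨fun ⟨c, h⟩ => ⟨c / 2, fun p hp => ?_⟩, fun ⟨c, h⟩ => ⟨2 * c, fun p hp => ?_⟩⟩, ?_⟩
  · have := hsum p hp
    rw [h p hp] at this
    linarith
  · rw [hsum p hp, h p hp]
  rintro ⟨c, hc⟩
  obtain ⟨b, hb⟩ := Orthonormal.exists_orthonormalBasis_extension_of_card_eq
    (𝕜 := ℝ) (E := E3) (ι := Fin 3) (by simp) (v := ![V₁, V₂, 0]) (s := {0, 1}) (by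
      constructor
      · rintro ⟨i, hi⟩
        rcases hi with rfl | rfl <;> simp [Set.domRestrict, hV₁, hV₂]
      · rintro ⟨i, hi⟩ ⟨j, hj⟩ hij
        rcases hi with rfl | rfl <;> rcases hj with rfl | rfl <;>
          simp_all [Set.domRestrict, real_inner_comm])
  have b0 : b 0 = V₁ := hb 0 (by simp)
  have b1 : b 1 = V₂ := hb 1 (by simp)
  have r0 : ∀ p, b.repr (n p) 0 = inner ℝ (n p) V₁ := fun p => by
    rw [b.repr_apply_apply, b0, real_inner_comm]
  have r1 : ∀ p, b.repr (n p) 1 = inner ℝ (n p) V₂ := fun p => by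
    rw [b.repr_apply_apply, b1, real_inner_comm]
  -- If `F = c` then `F' = c / 2`, so the constant of proportionality is `exp (c / 2)`.
  have hreg : ∀ p, (1 - b.repr (n p) 0 ^ 2) * (1 - b.repr (n p) 1 ^ 2) ≠ 0 →
      (1 - b.repr (n p) 0 ^ 2) * (1 - b.repr (n p) 1 ^ 2) =
        Real.exp (c / 2) * (-gaussCurvature X n p) := by
    intro p hp
    rw [r0, r1] at hp ⊢
    have hreg : p ∈ scherkRegular n V₁ V₂ := by
      refine ⟨fun h => hp ?_, fun h => hp ?_, fun h => hp ?_, fun h => hp ?_⟩ <;>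
        simp [h, hV₁, hV₂]
    obtain ⟨h1, h2, h3, h4⟩ := hreg
    have hpos := mul_pos (one_sub_inner_sq_pos hV₁ (hO.normal_unit p) h1 h2)
      (one_sub_inner_sq_pos hV₂ (hO.normal_unit p) h3 h4)
    have k : 0 < -gaussCurvature X n p := neg_pos.2 (hK p)
    have hl : scherkLog X n V₁ V₂ p = c / 2 := by
      have := hsum p ⟨h1, h2, h3, h4⟩
      rw [hc p ⟨h1, h2, h3, h4⟩] at this
      linarith
    rw [← hl, scherkLog, Real.exp_log (div_pos hpos k), div_mul_cancel₀ _ k.ne']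
  have hS : ∀ p, n p ∉ ({V₁, -V₁, V₂, -V₂} : Finset E3) →
      (1 - b.repr (n p) 0 ^ 2) * (1 - b.repr (n p) 1 ^ 2) ≠ 0 := by
    intro p hp
    simp only [Finset.mem_insert, Finset.mem_singleton, not_or] at hp
    rw [r0, r1]
    exact (mul_pos (one_sub_inner_sq_pos hV₁ (hO.normal_unit p) hp.1 hp.2.1)
      (one_sub_inner_sq_pos hV₂ (hO.normal_unit p) hp.2.2.1 hp.2.2.2)).ne'
  obtain ⟨h, h0, H⟩ := exists_hasConstPhase hX hK b.repr (Real.exp_pos (c / 2)) hreg _ hS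
  obtain ⟨B', h', H', h0', hre, him⟩ := H.exists_quadrant h0
  exact H'.isSimilarToPartOf hO h0' hre him
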